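/- Let $H$ be a real Hilbert space and let $L:\mathscr D(L)\subset H\to H$ be densely defined, self-adjoint and positive definite with a compact inverse. Let $\{e_j\}_{j\in\mathbb N}$ be an orthonormal basis of $H$ of eigenvectors of $L$, with eigenvalues $0<\lambda_1\le\lambda_2\le\dots$ in nondecreasing order, and assume that, for some $\alpha>0$ and $c_\lambda,C_\lambda>0$, $c_\lambda j^\alpha\le\lambda_j\le C_\lambda j^\alpha$ for all $j\in\mathbb N$. For $\sigma>0$ put $L^\sigma\phi=\sum_j\lambda_j^\sigma(\phi,e_j)_He_j$ on $\dot H^{2\sigma}:=\mathscr D(L^\sigma)=\{\phi\in H:\sum_j\lambda_j^{2\sigma}(\phi,e_j)_H^2<\infty\}$, and let $\dot H^{-2\sigma}$ be the dual space of $\dot H^{2\sigma}$ after identification via the inner product of $H$. Let $\beta\in(0,1)$, let $\xi_1,\xi_2,\dots$ be independent standard normal random variables on a probability space $(\Omega,\mathcal A,\mathbb P)$, and let $\mathcal W=\sum_j\xi_je_j$ be the associated Gaussian white noise. For $g\in H$, a solution of $L^\beta u=g+\mathcal W$ is a map $u:\Omega\to H$ such that $\mathbb P$-a.s. the equation holds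 in $\dot H^{-2\beta}$, i.e. $(u,L^\beta\phi)_H=(g,\phi)_H+\sum_j\xi_j(e_j,\phi)_H$ for all $\phi\in\dot H^{2\beta}$. Let $(V_h)_{h\in(0,1)}$ be finite-dimensional subspaces of $\dot H^1$, $N_h=\dim V_h$, let $\Pi_h:H\to V_h$ be the $H$-orthogonal projection, and let $L_h:V_h\to V_h$ be the Galerkin operator, $(L_h\psi,\phi)_H=(L^{1/2}\psi,L^{1/2}\phi)_H$ for $\psi,\phi\in V_h$. Let $\{e_{j,h}\}_{j=1}^{N_h}$ be an $H$-orthonormal basis of $V_h$ of eigenvectors of $L_h$ with eigenvalues $\lambda_{1,h}\le\dots\le\lambda_{N_h,h}$. Assume that there are $d\in\mathbb N=\{1,2,\dots\}$ and $c,c'>0$ with $c\,h^{-d}\le N_h\le c'h^{-d}$ for all $h\in(0,1)$, and constants $C_1,C_2>0$, $h_0\in(0,1)$, $r,s>0$, $q>1$ with $$\lambda_j\le\lambda_{j,h}\le\lambda_j+C_1h^r\lambda_j^q,\qquad \|e_j-e_{j,h}\|_H^2\le C_2h^{2s}\lambda_j^q$$ for all $h\in(0,h_0)$ and $j\in\{1,\dots,N_h\}$.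 For a basis $\Phi=\{\phi_{j,h}\}_{j=1}^{N_h}$ of $V_h$ put $\mathcal W_h^\Phi=\sum_{j=1}^{N_h}\tilde\xi_j\phi_{j,h}$ with $\tilde\xi=R^{-1}(\xi_1,\dots,\xi_{N_h})^T$, $R_{ij}=(e_{i,h},\phi_{j,h})_H$. For $k>0$ let $y_\ell=\ell k$, $K^-=\lceil\pi^2/(4\beta k^2)\rceil$, $K^+=\lceil\pi^2/(4(1-\beta)k^2)\rceil$, $$Q^\beta_{h,k}=\frac{2k\sin(\pi\beta)}{\pi}\sum_{\ell=-K^-}^{K^+}e^{2\beta y_\ell}(I+e^{2y_\ell}L_h)^{-1},\qquad u^Q_{h,k}=Q^\beta_{h,k}(\Pi_hg+\mathcal W_h^\Phi).$$ Assume $$\frac1{2\beta}<\alpha\le\min\Bigl\{\frac r{(q-1)d},\frac{2s}{qd}\Bigr\},$$ and that neither of the following two borderline cases occurs: (i) $\alpha=\frac r{(q-1)d}$ and $d(\alpha\beta-\frac12)=r\le s$; (ii) $\alpha=\frac{2s}{qd}$ and $d(\alpha\beta-\frac12)=s\le r$. Then there are $k_0>0$ and $C>0$ such that for every $g\in H$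 the equation $L^\beta u=g+\mathcal W$ has a solution $u\in L_2(\Omega;H)$, unique up to $\mathbb P$-a.s. equality, and for all $h\in(0,h_0)$, $k\in(0,k_0)$ and every basis $\Phi$ of $V_h$ one has $u^Q_{h,k}\in L_2(\Omega;H)$ and $$\|u-u^Q_{h,k}\|_{L_2(\Omega;H)}\le C\Bigl(h^{\min\{d(\alpha\beta-1/2),\,r,\,s\}}+e^{-\pi^2/(2k)}h^{-d/2}\Bigr)(1+\|g\|_H).$$ The constant $C$ is independent of $h$, $k$, $g$ and $\Phi$. -/

import Mathlib

open MeasureTheory ProbabilityTheory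
open scoped RealInnerProductSpace

noncomputable section

namespace FracSPDE

variable {H : Type*} [NormedAddCommGroup H] [InnerProductSpace ℝ H]

/-- A densely defined, self-adjoint, positive definite linear operator `L : D(L) ⊂ H → H`
with a compact inverse. -/
structure IsAdmissibleOperator [CompleteSpace H] (L : H →ₗ.[ℝ] H) : Prop where
  dense_domain : Dense (L.domain : Set H)
  selfAdjoint : IsSelfAdjoint L
  posDef : ∀ x : L.domain, (x : H) ≠ 0 → 0 < ⟪L x, (x : H)⟫
  compact_inverse : ∃ T : H →L[ℝ] H, IsCompactOperator T ∧
    (∀ x : L.domain, T (L x) = x) ∧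
    ∀ y : H, ∃ hy : T y ∈ L.domain, L ⟨T y, hy⟩ = y

/-- `e` is an orthonormal basis of eigenvectors of `L`, with the eigenvalues `lam` arranged in
nondecreasing order. The numbering starts at `0`: `lam j` and `e j` are the
`(j + 1)`-st eigenvalue and eigenvector. -/
structure IsEigenbasis (L : H →ₗ.[ℝ] H) (e : HilbertBasis ℕ ℝ H) (lam : ℕ → ℝ) : Prop where
  eigen : ∀ j, ∃ hj : e j ∈ L.domain, L ⟨e j, hj⟩ = lam j • e j
  mono : Monotone lam

/-- Eigenvalue growth `lam_j ∝ j ^ α` (in one-based numbering). -/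
def EigenvalueGrowth (lam : ℕ → ℝ) (α : ℝ) : Prop :=
  ∃ c C : ℝ, 0 < c ∧ 0 < C ∧
    ∀ j : ℕ, c * ((j : ℝ) + 1) ^ α ≤ lam j ∧ lam j ≤ C * ((j : ℝ) + 1) ^ α

theorem memlp_of_summable_sq {a : ℕ → ℝ} (h : Summable fun j => a j ^ 2) :
    Memℓp a 2 := by
  refine memℓp_gen ?_
  simpa using h

theorem summable_sq_of_memlp {a : ℕ → ℝ} (h : Memℓp a 2) :
    Summable fun j => a j ^ 2 := by
  have := h.summable (by norm_num)
  simpa using this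

/-- The domain `D(L^β) = {ψ ∈ H : ∑_j lam_j ^ (2 β) ⟪ψ, e_j⟫² < ∞}`, i.e. the space `Ḣ^{2 β}`. -/
def fracDomain (e : HilbertBasis ℕ ℝ H) (lam : ℕ → ℝ) (β : ℝ) : Submodule ℝ H where
  carrier := {ψ | Summable fun j => (lam j ^ β * ⟪e j, ψ⟫) ^ 2}
  zero_mem' := by simp [summable_zero]
  add_mem' := by
    intro x y hx hy
    have h := summable_sq_of_memlp ((memlp_of_summable_sq hx).add (memlp_of_summable_sq hy))
    simpa [inner_add_right, mul_add] using h
  smul_mem' := by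
    intro c x hx
    have h := Summable.mul_left (c ^ 2) hx
    refine h.congr fun j => ?_
    rw [real_inner_smul_right]
    ring

/-- The fractional power `L^β φ = ∑_j lam_j ^ β ⟪φ, e_j⟫ e_j` on its domain `D(L^β)`;
`e.repr.symm` maps a square summable sequence `a` to `∑_j a_j e_j`. -/
def fracPow (e : HilbertBasis ℕ ℝ H) (lam : ℕ → ℝ) (β : ℝ) : H →ₗ.[ℝ] H where
  domain := fracDomain e lam β
  toFun :=
    { toFun := fun φ =>
        e.repr.symm ⟨fun j => lam j ^ β * ⟪e j, (φ : H)⟫, memlp_of_summable_sq φ.2⟩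
      map_add' := by
        intro x y
        rw [← map_add]
        congr 1
        ext j
        simp only [Submodule.coe_add, inner_add_right, mul_add]
        rfl
      map_smul' := by
        intro c x
        rw [← map_smul]
        congr 1
        ext j
        simp [real_inner_smul_right]
        ring }

/-- The series representation of `L^β φ`. -/
theorem hasSum_fracPow (e : HilbertBasis ℕ ℝ H) (lam : ℕ → ℝ) (β : ℝ)
    (φ : (fracPow e lam β).domain) :
    HasSum (fun j => (lam j ^ β * ⟪e j, (φ : H)⟫) • e j) (fracPow e lam β φ) :=
  e.hasSum_repr_symm _

/-- `(ξ_j)` is a sequence of independent, real-valued, standard normally distributed random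
variables. The white noise is the formal series `W = ∑_j ξ_j e_j`. -/
def IsStdNormalSeq {Ω : Type*} [MeasurableSpace Ω] (μ : Measure Ω) (ξ : ℕ → Ω → ℝ) : Prop :=
  (∀ j, HasLaw (ξ j) (gaussianReal 0 1) μ) ∧ iIndepFun ξ μ

/-- The `H`-valued random variable `u` solves `L^β u = g + W`, where `W = ∑_j ξ_j e_j` is Gaussian
white noise: almost surely, the equality holds in the dual space of `D(L^β) = Ḣ^{2 β}`
(identified via the inner product of `H`). Here `L^β u` is the functional `φ ↦ ⟪u, L^β φ⟫`
(the continuous extension of `L^β` to `H`), and `g + W` is the functional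
`φ ↦ ⟪g, φ⟫ + ∑_j ξ_j ⟪e_j, φ⟫`. -/
def IsSolution (e : HilbertBasis ℕ ℝ H) (lam : ℕ → ℝ) (β : ℝ)
    {Ω : Type*} [MeasurableSpace Ω] (μ : Measure Ω) (ξ : ℕ → Ω → ℝ) (g : H) (u : Ω → H) : Prop :=
  ∀ᵐ ω ∂μ, ∀ φ : (fracPow e lam β).domain,
    HasSum (fun j => ξ j ω * ⟪e j, (φ : H)⟫) (⟪u ω, fracPow e lam β φ⟫ - ⟪g, (φ : H)⟫)

/-- The restriction of `L^{1/2} : Ḣ^1 → H` to a finite-dimensional subspace `V ⊂ Ḣ^1`. -/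
def sqrtRestrict (e : HilbertBasis ℕ ℝ H) (lam : ℕ → ℝ) (V : Submodule ℝ H)
    [FiniteDimensional ℝ V] (hV : V ≤ fracDomain e lam (1 / 2)) : V →L[ℝ] H :=
  LinearMap.toContinuousLinearMap
    ((fracPow e lam (1 / 2)).toFun ∘ₗ Submodule.inclusion hV)

/-- The Galerkin discretization `L_h : V → V` of `L : Ḣ^1 → Ḣ^{-1}` on a finite-dimensional
subspace `V ⊂ Ḣ^1`. It is built as `A* A` with `A = L^{1/2}` restricted to `V`, so that
`⟪L_h ψ, φ⟫ = ⟪L^{1/2} ψ, L^{1/2} φ⟫`, which is the duality pairing `⟨L ψ, φ⟩`;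
see `inner_galerkin`. -/
def galerkin [CompleteSpace H] (e : HilbertBasis ℕ ℝ H) (lam : ℕ → ℝ) (V : Submodule ℝ H)
    [FiniteDimensional ℝ V] (hV : V ≤ fracDomain e lam (1 / 2)) : V →ₗ[ℝ] V :=
  haveI : CompleteSpace V := FiniteDimensional.complete ℝ V
  (ContinuousLinearMap.adjoint (sqrtRestrict e lam V hV) ∘L sqrtRestrict e lam V hV :
    V →L[ℝ] V).toLinearMap

theorem inner_galerkin [CompleteSpace H] (e : HilbertBasis ℕ ℝ H) (lam : ℕ → ℝ)
    (V : Submodule ℝ H) [FiniteDimensional ℝ V] (hV : V ≤ fracDomain e lam (1 / 2)) (ψ φ : V) :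
    ⟪galerkin e lam V hV ψ, φ⟫ =
      ⟪fracPow e lam (1 / 2) ⟨ψ, hV ψ.2⟩, fracPow e lam (1 / 2) ⟨φ, hV φ.2⟩⟫ := by
  have : CompleteSpace V := FiniteDimensional.complete ℝ V
  exact ContinuousLinearMap.adjoint_inner_left (sqrtRestrict e lam V hV) φ
    (sqrtRestrict e lam V hV ψ)

/-- `eh` is an `H`-orthonormal basis of `V` of eigenvectors of the Galerkin operator `L_h`, with
the eigenvalues `lamh` in nondecreasing order (numbered from `0`). -/
structure IsGalerkinEigenbasis [CompleteSpace H] (e : HilbertBasis ℕ ℝ H) (lam : ℕ → ℝ)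
    (V : Submodule ℝ H) [FiniteDimensional ℝ V] (hV : V ≤ fracDomain e lam (1 / 2))
    (eh : OrthonormalBasis (Fin (Module.finrank ℝ V)) ℝ V)
    (lamh : Fin (Module.finrank ℝ V) → ℝ) : Prop where
  eigen : ∀ j, galerkin e lam V hV (eh j) = lamh j • eh j
  mono : Monotone lamh

/-- The assumption on the family `(V_h)`, `h ∈ (0, 1)`, of finite element spaces with discrete
eigenpairs `(lamh, eh)`: `dim V_h ∝ h ^ (-d)`, and the discrete eigenvalues and eigenvectors
approximate the exact ones for all `h ∈ (0, h₀)`. -/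
structure FEAssumption (e : HilbertBasis ℕ ℝ H) (lam : ℕ → ℝ)
    (V : Set.Ioo (0 : ℝ) 1 → Submodule ℝ H)
    (eh : ∀ h, OrthonormalBasis (Fin (Module.finrank ℝ (V h))) ℝ (V h))
    (lamh : ∀ h, Fin (Module.finrank ℝ (V h)) → ℝ)
    (d : ℕ) (h₀ C₁ C₂ r s q : ℝ) : Prop where
  d_pos : 0 < d
  h₀_mem : h₀ ∈ Set.Ioo (0 : ℝ) 1
  C₁_pos : 0 < C₁
  C₂_pos : 0 < C₂
  r_pos : 0 < r
  s_pos : 0 < s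
  one_lt_q : 1 < q
  dim : ∃ c C : ℝ, 0 < c ∧ 0 < C ∧ ∀ h : Set.Ioo (0 : ℝ) 1,
    c * (h : ℝ) ^ (-(d : ℝ)) ≤ Module.finrank ℝ (V h) ∧
      (Module.finrank ℝ (V h) : ℝ) ≤ C * (h : ℝ) ^ (-(d : ℝ))
  eigenvalues : ∀ h : Set.Ioo (0 : ℝ) 1, (h : ℝ) < h₀ → ∀ j : Fin (Module.finrank ℝ (V h)),
    lam j ≤ lamh h j ∧ lamh h j ≤ lam j + C₁ * (h : ℝ) ^ r * lam j ^ q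
  eigenvectors : ∀ h : Set.Ioo (0 : ℝ) 1, (h : ℝ) < h₀ → ∀ j : Fin (Module.finrank ℝ (V h)),
    ‖e j - (eh h j : H)‖ ^ 2 ≤ C₂ * (h : ℝ) ^ (2 * s) * lam j ^ q

/-- The noise approximation `W_h^Φ = ∑_j ξ̃_j φ_j` with respect to an arbitrary basis `Φ` of `V`,
where `ξ̃ = R⁻¹ ξ`, `R_ij = ⟪e_{i,h}, φ_j⟫` and `ξ` is the vector of the first `dim V` variables. -/
def noiseApprox {V : Submodule ℝ H}
    (eh : OrthonormalBasis (Fin (Module.finrank ℝ V)) ℝ V)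
    (Φ : Module.Basis (Fin (Module.finrank ℝ V)) ℝ V)
    {Ω : Type*} (ξ : ℕ → Ω → ℝ) (ω : Ω) : V :=
  let R : Matrix (Fin (Module.finrank ℝ V)) (Fin (Module.finrank ℝ V)) ℝ :=
    Matrix.of fun i j => ⟪eh i, Φ j⟫
  ∑ j, (R⁻¹.mulVec fun i => ξ i ω) j • Φ j

/-- The quadrature
`Q = (2 k sin(π β) / π) ∑_{l = -K⁻}^{K⁺} exp(2 β y_l) (I + exp(2 y_l) A)⁻¹`, where `y_l = l k`,
`K⁻ = ⌈π² / (4 β k²)⌉` and `K⁺ = ⌈π² / (4 (1 - β) k²)⌉`, applied to an operator `A` on `V`. -/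
def quadrature {V : Type*} [AddCommGroup V] [Module ℝ V] (A : Module.End ℝ V) (β k : ℝ) :
    Module.End ℝ V :=
  (2 * k * Real.sin (Real.pi * β) / Real.pi) •
    ∑ l ∈ Finset.Icc (-⌈Real.pi ^ 2 / (4 * β * k ^ 2)⌉) ⌈Real.pi ^ 2 / (4 * (1 - β) * k ^ 2)⌉,
      Real.exp (2 * β * (l * k)) • Ring.inverse (1 + Real.exp (2 * (l * k)) • A)

/-- The resolvents in the quadrature of the Galerkin operator are genuine inverses. -/
theorem isUnit_one_add_smul_galerkin [CompleteSpace H] (e : HilbertBasis ℕ ℝ H) (lam : ℕ → ℝ)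
    (V : Submodule ℝ H) [FiniteDimensional ℝ V] (hV : V ≤ fracDomain e lam (1 / 2))
    {t : ℝ} (ht : 0 ≤ t) :
    IsUnit (1 + t • galerkin e lam V hV : Module.End ℝ V) := by
  rw [LinearMap.isUnit_iff_ker_eq_bot, LinearMap.ker_eq_bot']
  intro x hx
  have h1 : ⟪x + t • galerkin e lam V hV x, x⟫ = 0 := by
    have : x + t • galerkin e lam V hV x = 0 := hx
    rw [this, inner_zero_left]
  rw [inner_add_left, real_inner_smul_left, inner_galerkin] at h1
  have h2 := mul_nonneg ht
    (real_inner_self_nonneg (x := fracPow e lam (1 / 2) ⟨(x : H), hV x.2⟩))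
  have h3 := real_inner_self_nonneg (x := x)
  exact inner_self_eq_zero (𝕜 := ℝ).1 (by linarith)

/-- The numerical approximation `u^Q_{h,k} = Q_{h,k}^β (Π_h g + W_h^Φ)`, where `Π_h` is the
`H`-orthogonal projection onto `V = V_h`. -/
def approxSolution [CompleteSpace H] (e : HilbertBasis ℕ ℝ H) (lam : ℕ → ℝ)
    (V : Submodule ℝ H) [FiniteDimensional ℝ V] (hV : V ≤ fracDomain e lam (1 / 2))
    (eh : OrthonormalBasis (Fin (Module.finrank ℝ V)) ℝ V)
    (Φ : Module.Basis (Fin (Module.finrank ℝ V)) ℝ V) (β k : ℝ)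
    {Ω : Type*} (ξ : ℕ → Ω → ℝ) (g : H) (ω : Ω) : H :=
  (quadrature (galerkin e lam V hV) β k (V.orthogonalProjectionOnto g + noiseApprox eh Φ ξ ω) : V)

end FracSPDE

end

/-! Everything is diagonalised. With `a j = lam j ^ (-β)` the solution is `u = ∑ a_j (ξ_j + ⟪e_j,
g⟫) e_j`. It converges in mean square because `2αβ > 1` makes `a` square summable, and testing with
`e_i` forces these coefficients, hence uniqueness. The matrix `R` is the change of basis from `Φ` to
`eh`, so the discrete noise is `∑ ξ_j e_{j,h}` whatever `Φ` is, and the approximation is `∑ b_j (ξ_j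
+ ⟪e_{j,h}, g⟫) e_{j,h}` with `b_j` the scalar quadrature at `lamh j`.

Since the `ξ_j` are orthonormal in `L²`, the squared stochastic error is `∑ ‖a_j e_j - b_j
e_{j,h}‖²`, with `b_j = 0` past the dimension `N`; the same sum and a companion control the
deterministic load (`eLpNorm_seriesSolution_sub_le`). Four contributions remain
(`exists_error_sums_le`): the tail beyond `N`, of order `h^(2d(αβ-1/2))`; the eigenvector and
eigenvalue errors, which are power sums in `j` carrying `h^(2s)` and `h^(2r)`; and the quadrature
error, `N` times the square of a scalar error. The upper bound on `α` makes the power sums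
absorbable, and the two borderline cases are those in which a harmonic sum would produce a
logarithm.

The scalar error, uniform for arguments bounded away from `0`, comes from Poisson summation: the
quadrature is a trapezoidal rule for an integral representing `x ^ (-β)`, whose integrand has an
explicit, exponentially decaying Fourier transform. -/

noncomputable section

namespace FracSPDE

/-! ### The kernel of the sinc quadrature and its Fourier transform. -/

open Filter Topology FourierTransform

/-- The substitution `x = sigmoid t` turns the beta integral for `Γ(s) Γ(1 - s)` into this one; the
value is the reflection formula. -/
theorem integral_exp_mul_div_one_add_exp {s : ℂ} (h0 : 0 < s.re) (h1 : s.re < 1) :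
    ∫ t : ℝ, Complex.exp (s * t) / (1 + Complex.exp t) = Real.pi / Complex.sin (Real.pi * s) := by
  have h1' : 0 < (1 - s).re := by simpa using h1
  rw [← Complex.Gamma_mul_Gamma_one_sub, Complex.Gamma_mul_Gamma_eq_betaIntegral h0 h1']
  have : s + (1 - s) = 1 := by ring
  rw [this, Complex.Gamma_one, one_mul, Complex.betaIntegral,
    intervalIntegral.integral_of_le zero_le_one, integral_Ioc_eq_integral_Ioo,
    ← Real.range_sigmoid, ← Set.image_univ,
    integral_image_eq_integral_abs_deriv_smul MeasurableSet.univ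
      (fun x _ => (Real.hasDerivAt_sigmoid x).hasDerivWithinAt) Real.sigmoid_injective.injOn,
    setIntegral_univ]
  congr 1
  ext t
  have hp : 0 < 1 + Real.exp t := by positivity
  -- With this logarithm, `sigmoid t = e^(t-l)` and `1 - sigmoid t = e^(-l)`, so every complex power
  -- becomes an exponential.
  set l := Real.log (1 + Real.exp t) with hl
  have hel : Real.exp l = 1 + Real.exp t := Real.exp_log hp
  have e1 : Real.sigmoid t = Real.exp (t - l) := by
    rw [Real.exp_sub, hel, Real.sigmoid_def, Real.exp_neg]
    field_simp
    ring
  have e2 : 1 - Real.sigmoid t = Real.exp (-l) := by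
    rw [e1, Real.exp_sub, Real.exp_neg, hel]
    field_simp
    ring
  have e3 : (1 : ℂ) - (Real.sigmoid t : ℂ) = Complex.exp ((-l : ℝ) : ℂ) := by
    rw [← Complex.ofReal_exp, ← e2]; simp
  have e4 : (1 : ℂ) + Complex.exp t = Complex.exp (l : ℂ) := by
    rw [← Complex.ofReal_exp l, hel]; simp
  have e5 : (Real.sigmoid t : ℂ) = Complex.exp ((t - l : ℝ) : ℂ) := by
    rw [← Complex.ofReal_exp, ← e1]
  have hpow : ∀ (x : ℝ) (z : ℂ), Complex.exp (x : ℂ) ^ z = Complex.exp (x * z) := by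
    intro x z
    rw [Complex.cpow_def_of_ne_zero (Complex.exp_ne_zero _), ← Complex.ofReal_exp,
      ← Complex.ofReal_log (Real.exp_pos x).le, Real.log_exp]
  rw [e3, e4, e5, hpow, hpow, e2, e1, abs_of_pos (by positivity), Complex.real_smul,
    Complex.ofReal_mul, Complex.ofReal_exp, Complex.ofReal_exp, ← Complex.exp_sub, ← Complex.exp_add,
    ← Complex.exp_add, ← Complex.exp_add]
  congr 1
  push_cast
  ring

/-- Reverse triangle inequality for the two exponentials of the sine. This makes `π / sin` decay
away from the real axis. -/
theorem abs_sinh_le_norm_sin (z : ℂ) : |Real.sinh z.im| ≤ ‖Complex.sin z‖ := by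
  have h1 : ‖Complex.exp (-z * Complex.I)‖ = Real.exp z.im := by
    rw [Complex.norm_exp]; simp
  have h2 : ‖Complex.exp (z * Complex.I)‖ = Real.exp (-z.im) := by
    rw [Complex.norm_exp]; simp
  have h3 : ‖Complex.sin z‖ = ‖Complex.exp (-z * Complex.I) - Complex.exp (z * Complex.I)‖ / 2 := by
    rw [Complex.sin]; simp
  rw [h3, Real.sinh_eq, abs_div, abs_two, ← h1, ← h2]
  gcongr
  exact abs_norm_sub_norm_le _ _

theorem exp_abs_le_abs_sinh {b : ℝ} (hb : 1 ≤ |b|) : Real.exp |b| / 4 ≤ |Real.sinh b| := by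
  rw [Real.abs_sinh, Real.sinh_eq]
  have h1 : Real.exp (-|b|) ≤ 1 := Real.exp_le_one_iff.2 (by linarith)
  have h2 : 2 ≤ Real.exp |b| := by linarith [Real.add_one_le_exp |b|]
  linarith

/-- The integrand of the Balakrishnan-type integral representation of `λ ^ (-β)`. -/
def sincKernel (β k : ℝ) (x : ℝ) : ℂ :=
  Complex.exp (2 * β * k * x) / (1 + Complex.exp (2 * k * x))

theorem sincKernel_ofReal (β k x : ℝ) :
    sincKernel β k x = ((Real.exp (2 * β * k * x) / (1 + Real.exp (2 * k * x)) : ℝ) : ℂ) := by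
  simp [sincKernel]

theorem continuous_sincKernel (β k : ℝ) : Continuous (sincKernel β k) := by
  rw [show sincKernel β k = fun x => _ from funext (sincKernel_ofReal β k)]
  refine Complex.continuous_ofReal.comp (Continuous.div (by fun_prop) (by fun_prop) ?_)
  intro x
  positivity

/-- Rescaling by `t = 2kx` gives the preceding integral at `s = β - iπw/k`, whose real part stays in
`(0, 1)`. -/
theorem fourier_sincKernel {β k : ℝ} (hβ : β ∈ Set.Ioo (0 : ℝ) 1) (hk : 0 < k) (w : ℝ) :
    𝓕 (sincKernel β k) w =
      ((2 * k : ℝ) : ℂ)⁻¹ * (Real.pi / Complex.sin (Real.pi * (β - Real.pi * w / k * Complex.I))) := by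
  have hre : ((β : ℂ) - Real.pi * w / k * Complex.I).re = β := by
    rw [show (Real.pi * w / k : ℂ) = ((Real.pi * w / k : ℝ) : ℂ) by push_cast; ring]
    simp
  rw [← integral_exp_mul_div_one_add_exp (by rw [hre]; exact hβ.1) (by rw [hre]; exact hβ.2),
    Real.fourier_real_eq_integral_exp_smul]
  set s : ℂ := (β : ℂ) - Real.pi * w / k * Complex.I with hs
  have := Measure.integral_comp_mul_left
    (fun t : ℝ => Complex.exp (s * t) / (1 + Complex.exp t)) (2 * k)
  rw [abs_of_pos (by positivity), Complex.real_smul] at this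
  rw [Complex.ofReal_inv] at this
  rw [← this]
  congr 1
  ext x
  rw [sincKernel, smul_eq_mul, ← mul_div_assoc, ← Complex.exp_add]
  congr 2
  have hk' : (k : ℂ) ≠ 0 := by exact_mod_cast hk.ne'
  · rw [hs]
    push_cast
    field_simp
    ring
  · push_cast; ring

/-- Decay hypothesis for Poisson summation. The kernel decays exponentially at rate `2k min(β,
1-β)`; `e^y ≥ y²/2` weakens this to a power. -/
theorem sincKernel_isBigO {β k : ℝ} (hβ : β ∈ Set.Ioo (0 : ℝ) 1) (hk : 0 < k) :
    sincKernel β k =O[cocompact ℝ] fun x : ℝ => |x| ^ (-2 : ℝ) := by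
  obtain ⟨h0, h1⟩ := hβ
  set c := 2 * k * min β (1 - β) with hc
  have hcpos : 0 < c := by
    have : 0 < min β (1 - β) := lt_min h0 (by linarith)
    positivity
  refine Asymptotics.IsBigO.of_bound (2 / c ^ 2) ?_
  have hne : ∀ᶠ x : ℝ in cocompact ℝ, x ≠ 0 := by
    have := (isCompact_singleton (x := (0 : ℝ))).compl_mem_cocompact
    filter_upwards [this] with x hx using hx
  filter_upwards [hne] with x hx
  have hx' : 0 < |x| := abs_pos.2 hx
  have key : Real.exp (2 * β * k * x) / (1 + Real.exp (2 * k * x)) ≤ Real.exp (-(c * |x|)) := by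
    rw [div_le_iff₀ (by positivity), mul_add, mul_one, ← Real.exp_add]
    rcases le_total 0 x with h | h
    · have : 2 * β * k * x ≤ -(c * |x|) + 2 * k * x := by
        rw [abs_of_nonneg h, hc]
        nlinarith [mul_le_mul_of_nonneg_left (min_le_right β (1 - β)) (mul_nonneg hk.le h)]
      linarith [Real.exp_le_exp.2 this, Real.exp_pos (-(c * |x|))]
    · have : 2 * β * k * x ≤ -(c * |x|) := by
        rw [abs_of_nonpos h, hc]
        nlinarith [mul_le_mul_of_nonneg_left (min_le_left β (1 - β))
          (mul_nonneg hk.le (neg_nonneg.2 h))]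
      linarith [Real.exp_le_exp.2 this, Real.exp_pos (-(c * |x|) + 2 * k * x)]
  rw [sincKernel_ofReal, Complex.norm_real, Real.norm_of_nonneg (by positivity),
    Real.norm_of_nonneg (by positivity)]
  refine key.trans ?_
  have hq := Real.quadratic_le_exp_of_nonneg (x := c * |x|) (by positivity)
  rw [Real.exp_neg, Real.rpow_neg hx'.le, Real.rpow_two, ← div_eq_mul_inv, div_div, ← one_div]
  rw [div_le_div_iff₀ (by positivity) (by positivity)]
  nlinarith [mul_pos hcpos hx']

/-- At frequency `n` the argument of the sine has imaginary part `-π²n/k`. For `k < 1` and `n ≠ 0`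
its modulus exceeds `1`, so the bound on `sinh` applies. -/
theorem norm_fourier_sincKernel_le {β k : ℝ} (hβ : β ∈ Set.Ioo (0 : ℝ) 1) (hk : 0 < k)
    (hk1 : k < 1) {n : ℤ} (hn : n ≠ 0) :
    ‖𝓕 (sincKernel β k) (n : ℝ)‖ ≤
      (2 * k)⁻¹ * (Real.pi * (4 * Real.exp (-(Real.pi ^ 2 / k)) ^ n.natAbs)) := by
  have hna : (1 : ℝ) ≤ n.natAbs := by exact_mod_cast Int.natAbs_pos.2 hn
  have hπ := Real.pi_gt_three
  have him : ((Real.pi : ℂ) * (β - Real.pi * (n : ℝ) / k * Complex.I)).im =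
      -(Real.pi ^ 2 * n / k) := by
    rw [show ((Real.pi : ℂ) * (β - Real.pi * (n : ℝ) / k * Complex.I)) =
      ((Real.pi * β : ℝ) : ℂ) + ((-(Real.pi ^ 2 * n / k) : ℝ) : ℂ) * Complex.I by
        push_cast; ring, Complex.add_im, Complex.im_ofReal_mul]
    simp
  have habs : |-(Real.pi ^ 2 * (n : ℝ) / k)| = Real.pi ^ 2 / k * n.natAbs := by
    rw [abs_neg, abs_div, abs_mul, abs_of_pos hk, abs_of_pos (by positivity), Nat.cast_natAbs,
      Int.cast_abs]
    ring
  have hbig : 1 ≤ Real.pi ^ 2 / k * n.natAbs := by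
    have : 1 ≤ Real.pi ^ 2 / k := by rw [le_div_iff₀ hk]; nlinarith
    nlinarith
  rw [fourier_sincKernel hβ hk, norm_mul, norm_div, norm_inv, Complex.norm_real,
    Complex.norm_real, Real.norm_of_nonneg Real.pi_pos.le,
    Real.norm_of_nonneg (by positivity : 0 ≤ 2 * k)]
  have hs := abs_sinh_le_norm_sin ((Real.pi : ℂ) * (β - Real.pi * (n : ℝ) / k * Complex.I))
  have hs2 := exp_abs_le_abs_sinh (b := -(Real.pi ^ 2 * (n : ℝ) / k)) (by rw [habs]; exact hbig)
  rw [him] at hs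
  rw [habs] at hs2
  have hs3 := hs2.trans hs
  rw [div_eq_mul_inv]
  gcongr
  rw [← Real.exp_nat_mul, show (n.natAbs : ℝ) * -(Real.pi ^ 2 / k) =
    -(Real.pi ^ 2 / k * n.natAbs) by ring, Real.exp_neg]
  calc _ ≤ (Real.exp (Real.pi ^ 2 / k * n.natAbs) / 4)⁻¹ := by
        gcongr
    _ = _ := by field_simp

end FracSPDE

end

/-! ### Tails of the quadrature series. -/

noncomputable section

namespace FracSPDE

open Filter Topology FourierTransform

/-- The summands of the sinc quadrature. -/
def sincTerm (β k x : ℝ) (l : ℤ) : ℝ :=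
  Real.exp (2 * β * (l * k)) * (1 + Real.exp (2 * (l * k)) * x)⁻¹

theorem sincTerm_nonneg {β k x : ℝ} (hx : 0 < x) (l : ℤ) : 0 ≤ sincTerm β k x l := by
  unfold sincTerm; positivity

/-- Useful as `l → -∞`; the next bound, with rate `2(1-β)k`, serves `l → +∞`. -/
theorem sincTerm_le_exp {β k x : ℝ} (hx : 0 < x) (l : ℤ) :
    sincTerm β k x l ≤ Real.exp (2 * β * (l * k)) := by
  unfold sincTerm
  refine mul_le_of_le_one_right (by positivity) (inv_le_one_of_one_le₀ ?_)
  have : 0 ≤ Real.exp (2 * (l * k)) * x := by positivity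
  linarith

theorem sincTerm_le_exp_neg {β k x : ℝ} (hx : 0 < x) (l : ℤ) :
    sincTerm β k x l ≤ x⁻¹ * Real.exp (-(2 * (1 - β) * (l * k))) := by
  unfold sincTerm
  have h : (1 + Real.exp (2 * (l * k)) * x)⁻¹ ≤ (Real.exp (2 * (l * k)) * x)⁻¹ := by
    gcongr
    linarith
  calc _ ≤ Real.exp (2 * β * (l * k)) * (Real.exp (2 * (l * k)) * x)⁻¹ := by gcongr
    _ = _ := by
      rw [mul_inv, ← Real.exp_neg, ← mul_assoc, ← Real.exp_add, mul_comm]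
      congr 2
      ring

theorem summable_exp_neg_add_nat {c : ℝ} (hc : 0 < c) (m : ℕ) :
    Summable fun n : ℕ => Real.exp (-(c * (((m + 1 + n : ℕ) : ℝ)))) := by
  have : Summable fun n : ℕ => Real.exp (-(c * (m + 1))) * Real.exp (-c) ^ n :=
    (summable_geometric_of_lt_one (Real.exp_pos _).le
      (Real.exp_zero ▸ Real.exp_lt_exp.2 (neg_lt_zero.2 hc))).mul_left _
  refine this.congr fun n => ?_
  rw [← Real.exp_nat_mul, ← Real.exp_add]
  congr 1; push_cast; ring

/-- A geometric tail is bounded like the corresponding integral. -/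
theorem tsum_exp_neg_add_nat_le {c : ℝ} (hc : 0 < c) (m : ℕ) :
    ∑' n : ℕ, Real.exp (-(c * (((m + 1 + n : ℕ) : ℝ)))) ≤ c⁻¹ * Real.exp (-(c * m)) := by
  have hlt : Real.exp (-c) < 1 := Real.exp_zero ▸ Real.exp_lt_exp.2 (neg_lt_zero.2 hc)
  have e : ∀ n : ℕ, Real.exp (-(c * (((m + 1 + n : ℕ) : ℝ)))) =
      Real.exp (-(c * (m + 1))) * Real.exp (-c) ^ n := by
    intro n
    rw [← Real.exp_nat_mul, ← Real.exp_add]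
    congr 1; push_cast; ring
  simp_rw [e]
  rw [tsum_mul_left, tsum_geometric_of_lt_one (Real.exp_pos _).le hlt,
    show -(c * ((m : ℝ) + 1)) = -(c * m) + -c by ring, Real.exp_add, mul_assoc, mul_comm]
  gcongr
  -- What remains is `c e^(-c) ≤ 1 - e^(-c)`, that is, `1 + c ≤ e^c`.
  rw [← div_eq_mul_inv, div_le_iff₀ (by linarith), ← mul_inv_le_iff₀' (by positivity), inv_inv]
  have := Real.add_one_le_exp c
  have h1 : Real.exp (-c) * Real.exp c = 1 := by rw [← Real.exp_add]; simp
  nlinarith [Real.exp_pos (-c)]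

theorem summable_sincTerm_nat {β k x : ℝ} (hβ : β ∈ Set.Ioo (0 : ℝ) 1) (hk : 0 < k) (hx : 0 < x)
    (m : ℕ) : Summable fun n : ℕ => sincTerm β k x ((m + 1 + n : ℕ) : ℤ) := by
  have hc : 0 < 2 * (1 - β) * k := mul_pos (by linarith [hβ.2]) hk
  refine Summable.of_nonneg_of_le (fun n => sincTerm_nonneg hx _) (fun n => ?_)
    ((summable_exp_neg_add_nat hc m).mul_left x⁻¹)
  refine (sincTerm_le_exp_neg hx _).trans_eq ?_
  congr 3; push_cast; ring

theorem summable_sincTerm_neg {β k x : ℝ} (hβ : β ∈ Set.Ioo (0 : ℝ) 1) (hk : 0 < k) (hx : 0 < x)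
    (m : ℕ) : Summable fun n : ℕ => sincTerm β k x (-((m + 1 + n : ℕ) : ℤ)) := by
  have hc : 0 < 2 * β * k := mul_pos (by linarith [hβ.1]) hk
  refine Summable.of_nonneg_of_le (fun n => sincTerm_nonneg hx _) (fun n => ?_)
    (summable_exp_neg_add_nat hc m)
  refine (sincTerm_le_exp hx _).trans_eq ?_
  congr 1; push_cast; ring

theorem tsum_sincTerm_nat_le {β k x : ℝ} (hβ : β ∈ Set.Ioo (0 : ℝ) 1) (hk : 0 < k) (hx : 0 < x)
    (m : ℕ) : ∑' n : ℕ, sincTerm β k x ((m + 1 + n : ℕ) : ℤ) ≤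
      x⁻¹ * ((2 * (1 - β) * k)⁻¹ * Real.exp (-(2 * (1 - β) * k * m))) := by
  have hc : 0 < 2 * (1 - β) * k := mul_pos (by linarith [hβ.2]) hk
  calc _ ≤ ∑' n : ℕ, x⁻¹ * Real.exp (-(2 * (1 - β) * k * (((m + 1 + n : ℕ) : ℝ)))) := by
        refine (summable_sincTerm_nat hβ hk hx m).tsum_le_tsum (fun n => ?_)
          ((summable_exp_neg_add_nat hc m).mul_left x⁻¹)
        refine (sincTerm_le_exp_neg hx _).trans_eq ?_
        congr 3; push_cast; ring
    _ ≤ _ := by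
        rw [tsum_mul_left]
        gcongr
        exact tsum_exp_neg_add_nat_le hc m

theorem tsum_sincTerm_neg_le {β k x : ℝ} (hβ : β ∈ Set.Ioo (0 : ℝ) 1) (hk : 0 < k) (hx : 0 < x)
    (m : ℕ) : ∑' n : ℕ, sincTerm β k x (-((m + 1 + n : ℕ) : ℤ)) ≤
      (2 * β * k)⁻¹ * Real.exp (-(2 * β * k * m)) := by
  have hc : 0 < 2 * β * k := mul_pos (by linarith [hβ.1]) hk
  refine le_trans ?_ (tsum_exp_neg_add_nat_le hc m)
  refine (summable_sincTerm_neg hβ hk hx m).tsum_le_tsum (fun n => ?_)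
    (summable_exp_neg_add_nat hc m)
  refine (sincTerm_le_exp hx _).trans_eq ?_
  congr 1; push_cast; ring

/-- Splitting a sum over `ℤ` into a finite window and two tails. -/
theorem tsum_int_eq_sum_Icc_add {E : Type*} [NormedAddCommGroup E] {a : ℤ → E} (K M : ℕ)
    (hp : Summable fun n : ℕ => a ((M + 1 + n : ℕ) : ℤ))
    (hn : Summable fun n : ℕ => a (-((K + 1 + n : ℕ) : ℤ))) :
    ∑' l, a l = ∑ l ∈ Finset.Icc (-(K : ℤ)) M, a l +
      (∑' n : ℕ, a ((M + 1 + n : ℕ) : ℤ) + ∑' n : ℕ, a (-((K + 1 + n : ℕ) : ℤ))) := by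
  have hp0 : Summable fun n : ℕ => a n := by
    rw [← summable_nat_add_iff (M + 1)]
    refine hp.congr fun n => ?_
    rw [add_comm]
  have hn0 : Summable fun n : ℕ => a (-((n : ℤ) + 1)) := by
    rw [← summable_nat_add_iff K]
    refine hn.congr fun n => ?_
    congr 1; push_cast; ring
  rw [tsum_of_nat_of_neg_add_one hp0 hn0, ← hp0.sum_add_tsum_nat_add (M + 1),
    ← hn0.sum_add_tsum_nat_add K]
  have e1 : ∑' n : ℕ, a ((n + (M + 1) : ℕ) : ℤ) = ∑' n : ℕ, a ((M + 1 + n : ℕ) : ℤ) := by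
    congr 1; ext n; congr 1; push_cast; ring
  have e2 : ∑' n : ℕ, a (-(((n + K : ℕ) : ℤ) + 1)) = ∑' n : ℕ, a (-((K + 1 + n : ℕ) : ℤ)) := by
    congr 1; ext n; congr 1; push_cast; ring
  have e3 : ∑ l ∈ Finset.Icc (-(K : ℤ)) M, a l =
      ∑ i ∈ Finset.range (M + 1), a i + ∑ i ∈ Finset.range K, a (-((i : ℤ) + 1)) := by
    rw [← Finset.sum_image (s := Finset.range (M + 1)) (g := fun i : ℕ => (i : ℤ)) (f := a)
      (by intro x _ y _ h; simpa using h),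
      ← Finset.sum_image (s := Finset.range K) (g := fun i : ℕ => -((i : ℤ) + 1)) (f := a)
      (by intro x _ y _ h; simpa using h), ← Finset.sum_union]
    · congr 1
      ext l
      simp only [Finset.mem_Icc, Finset.mem_union, Finset.mem_image, Finset.mem_range]
      constructor
      · intro h
        rcases le_or_gt 0 l with hl | hl
        · exact Or.inl ⟨l.toNat, by omega, by omega⟩
        · exact Or.inr ⟨(-l - 1).toNat, by omega, by omega⟩
      · rintro (⟨i, hi, rfl⟩ | ⟨i, hi, rfl⟩) <;> omega
    · rw [Finset.disjoint_left]
      simp only [Finset.mem_image, Finset.mem_range, not_exists, not_and]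
      rintro _ ⟨i, hi, rfl⟩ j hj h
      omega
  rw [e1, e2, e3]
  abel

/-- In Poisson summation the zero frequency is the exact integral, so this difference is the
discretisation error. -/
theorem norm_tsum_int_sub_zero_le {g : ℤ → ℂ} {A ρ : ℝ} (h0 : 0 ≤ ρ) (h1 : ρ < 1)
    (hg : ∀ n, n ≠ 0 → ‖g n‖ ≤ A * ρ ^ n.natAbs) :
    Summable g ∧ ‖∑' n, g n - g 0‖ ≤ 2 * (A * (ρ * (1 - ρ)⁻¹)) := by
  have hs : HasSum (fun n : ℕ => A * ρ ^ (n + 1)) (A * (ρ * (1 - ρ)⁻¹)) := by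
    simp_rw [pow_succ']
    exact ((hasSum_geometric_of_lt_one h0 h1).mul_left ρ).mul_left A
  have b1 : ∀ n : ℕ, ‖g ((0 + 1 + n : ℕ) : ℤ)‖ ≤ A * ρ ^ (n + 1) := by
    intro n
    have := hg ((0 + 1 + n : ℕ) : ℤ) (by omega)
    rw [Int.natAbs_natCast] at this
    rwa [show n + 1 = 0 + 1 + n by ring]
  have b2 : ∀ n : ℕ, ‖g (-((0 + 1 + n : ℕ) : ℤ))‖ ≤ A * ρ ^ (n + 1) := by
    intro n
    have := hg (-((0 + 1 + n : ℕ) : ℤ)) (by omega)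
    rw [Int.natAbs_neg, Int.natAbs_natCast] at this
    rwa [show n + 1 = 0 + 1 + n by ring]
  have s1 : Summable fun n : ℕ => g ((0 + 1 + n : ℕ) : ℤ) := Summable.of_norm_bounded hs.summable b1
  have s2 : Summable fun n : ℕ => g (-((0 + 1 + n : ℕ) : ℤ)) :=
    Summable.of_norm_bounded hs.summable b2
  constructor
  · refine Summable.of_nat_of_neg_add_one ?_ ?_
    · rw [← summable_nat_add_iff 1]
      refine s1.congr fun n => ?_
      congr 1; push_cast; ring
    · refine s2.congr fun n => ?_
      congr 1; push_cast; ring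
  · rw [tsum_int_eq_sum_Icc_add 0 0 s1 s2]
    simp only [Nat.cast_zero, neg_zero, Finset.Icc_self, Finset.sum_singleton, add_sub_cancel_left]
    have := norm_add_le_of_le (tsum_of_norm_bounded hs b1) (tsum_of_norm_bounded hs b2)
    linarith

end FracSPDE

end

/-! ### Error of the scalar quadrature. -/

noncomputable section

namespace FracSPDE

open Filter Topology FourierTransform

/-- Exponential convergence of the (infinite) sinc quadrature for `x ^ (-β)`. -/
theorem abs_rpow_sub_tsum_sincTerm_le {β k x : ℝ} (hβ : β ∈ Set.Ioo (0 : ℝ) 1) (hk : 0 < k)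
    (hk1 : k < 1) (hx : 0 < x) :
    |x ^ (-β) - 2 * k * Real.sin (Real.pi * β) / Real.pi * ∑' l, sincTerm β k x l| ≤
      16 * x ^ (-β) * Real.exp (-(Real.pi ^ 2 / k)) := by
  set ρ := Real.exp (-(Real.pi ^ 2 / k)) with hρ
  have hπ := Real.pi_gt_three
  have hρ2 : ρ ≤ 1 / 2 := by
    have h1 : 1 ≤ Real.pi ^ 2 / k := by rw [le_div_iff₀ hk]; nlinarith
    have h2 := Real.add_one_le_exp (Real.pi ^ 2 / k)
    rw [hρ, Real.exp_neg, one_div]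
    exact inv_anti₀ two_pos (by linarith)
  have hρ0 : 0 < ρ := Real.exp_pos _
  -- Translating the kernel by this `a` makes its values at the integers equal to `x ^ β` times the
  -- quadrature terms.
  set a := Real.log x / (2 * k) with ha
  set g : ℤ → ℂ := fun n => 𝓕 (sincKernel β k) (n : ℝ) * fourier n (a : UnitAddCircle) with hg
  have hnf : ∀ n : ℤ, ‖fourier n (a : UnitAddCircle)‖ = 1 := fun n => Circle.norm_coe _
  obtain ⟨-, hb⟩ := norm_tsum_int_sub_zero_le (g := g)
    (A := (2 * k)⁻¹ * (Real.pi * 4)) hρ0.le (by linarith) (fun n hn => by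
      rw [hg, norm_mul, hnf, mul_one]
      exact (norm_fourier_sincKernel_le hβ hk hk1 hn).trans_eq (by ring))
  have hsum : Summable fun n : ℤ => 𝓕 (sincKernel β k) (n : ℝ) :=
    (norm_tsum_int_sub_zero_le (A := (2 * k)⁻¹ * (Real.pi * 4)) hρ0.le (by linarith) (fun n hn =>
      (norm_fourier_sincKernel_le hβ hk hk1 hn).trans_eq (by ring))).1
  have poisson := Real.tsum_eq_tsum_fourier_of_rpow_decay_of_summable (continuous_sincKernel β k)
    one_lt_two (sincKernel_isBigO hβ hk) hsum a
  have hterm : ∀ n : ℤ, sincKernel β k (a + n) = ((x ^ β * sincTerm β k x n : ℝ) : ℂ) := by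
    intro n
    have e1 : Real.exp (2 * k * (a + n)) = Real.exp (2 * (n * k)) * x := by
      conv_rhs => rw [← Real.exp_log hx, ← Real.exp_add]
      congr 1; rw [ha]; field_simp
      ring
    have e2 : Real.exp (2 * β * k * (a + n)) = x ^ β * Real.exp (2 * β * (n * k)) := by
      rw [Real.rpow_def_of_pos hx, ← Real.exp_add]
      congr 1; rw [ha]; field_simp
    rw [sincKernel_ofReal, e1, e2, sincTerm, div_eq_mul_inv, mul_assoc]
  simp_rw [hterm] at poisson
  rw [← Complex.ofReal_tsum, tsum_mul_left] at poisson
  have hsin : 0 < Real.sin (Real.pi * β) :=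
    Real.sin_pos_of_pos_of_lt_pi (by nlinarith [hβ.1]) (by nlinarith [hβ.2])
  -- The exact integral is the reciprocal of the quadrature's prefactor, so normalising turns it
  -- into `x ^ (-β)`.
  have hg0 : g 0 = (((2 * k)⁻¹ * (Real.pi / Real.sin (Real.pi * β)) : ℝ) : ℂ) := by
    rw [hg]
    simp only [Int.cast_zero, _root_.fourier_zero, mul_one]
    rw [fourier_sincKernel hβ hk]
    push_cast
    simp
  rw [← poisson, hg0, ← Complex.ofReal_sub, Complex.norm_real, Real.norm_eq_abs] at hb
  set S := ∑' l, sincTerm β k x l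
  have hxx : x ^ (-β) * x ^ β = 1 := by rw [← Real.rpow_add hx]; simp
  have e : x ^ (-β) - 2 * k * Real.sin (Real.pi * β) / Real.pi * S =
      -(x ^ (-β) * (2 * k * Real.sin (Real.pi * β) / Real.pi)) *
        (x ^ β * S - (2 * k)⁻¹ * (Real.pi / Real.sin (Real.pi * β))) := by
    have : x ^ (-β) * (2 * k * Real.sin (Real.pi * β) / Real.pi) *
        ((2 * k)⁻¹ * (Real.pi / Real.sin (Real.pi * β))) = x ^ (-β) := by
      have := hsin.ne'
      generalize Real.sin (Real.pi * β) = y at *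
      field_simp
    linear_combination this.symm - 2 * k * Real.sin (Real.pi * β) / Real.pi * S * hxx.symm
  have hxp : 0 < x ^ (-β) := Real.rpow_pos_of_pos hx _
  rw [e, abs_mul, abs_neg, abs_of_pos (by positivity)]
  have hsin1 := Real.sin_le_one (Real.pi * β)
  calc _ ≤ x ^ (-β) * (2 * k * 1 / Real.pi) * (2 * ((2 * k)⁻¹ * (Real.pi * 4) * (ρ * (1 - ρ)⁻¹))) := by
        gcongr
    _ = x ^ (-β) * (8 * (ρ * (1 - ρ)⁻¹)) := by field_simp; ring
    _ ≤ x ^ (-β) * (8 * (ρ * 2)) := by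
        gcongr
        rw [← inv_inv (2 : ℝ)]
        exact inv_anti₀ (by norm_num) (by linarith)
    _ = _ := by ring

/-- The scalar sinc quadrature approximating `x ^ (-β)`. -/
def scalarQuadrature (β k x : ℝ) : ℝ :=
  2 * k * Real.sin (Real.pi * β) / Real.pi *
    ∑ l ∈ Finset.Icc (-⌈Real.pi ^ 2 / (4 * β * k ^ 2)⌉) ⌈Real.pi ^ 2 / (4 * (1 - β) * k ^ 2)⌉,
      sincTerm β k x l

/-- The cut-offs make both truncation exponents at least `π²/(2k)`, so truncation dominates the
discretisation error `e^(-π²/k)`. The bounds involve `x` only through `x ^ (-β)` and `x⁻¹`, hence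
are uniform on `x ≥ x₀`. -/
theorem exists_abs_rpow_sub_scalarQuadrature_le {β x₀ : ℝ} (hβ : β ∈ Set.Ioo (0 : ℝ) 1)
    (hx₀ : 0 < x₀) : ∃ C : ℝ, 0 < C ∧ ∀ k : ℝ, 0 < k → k < 1 → ∀ x, x₀ ≤ x →
      |x ^ (-β) - scalarQuadrature β k x| ≤ C * Real.exp (-Real.pi ^ 2 / (2 * k)) := by
  have hβ0 := hβ.1
  have hβ1 : 0 < 1 - β := by linarith [hβ.2]
  refine ⟨16 * x₀ ^ (-β) + (x₀⁻¹ * (1 - β)⁻¹ + β⁻¹), by positivity, fun k hk hk1 x hx => ?_⟩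
  have hx0 : 0 < x := hx₀.trans_le hx
  have hπ := Real.pi_gt_three
  set E := Real.exp (-Real.pi ^ 2 / (2 * k)) with hE
  obtain ⟨K, hK⟩ := Int.eq_ofNat_of_zero_le
    (a := ⌈Real.pi ^ 2 / (4 * β * k ^ 2)⌉) (Int.ceil_nonneg (by positivity))
  obtain ⟨M, hM⟩ := Int.eq_ofNat_of_zero_le
    (a := ⌈Real.pi ^ 2 / (4 * (1 - β) * k ^ 2)⌉) (Int.ceil_nonneg (by positivity))
  have hK' : Real.pi ^ 2 / (4 * β * k ^ 2) ≤ K := by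
    have := Int.le_ceil (Real.pi ^ 2 / (4 * β * k ^ 2))
    rwa [hK] at this
  have hM' : Real.pi ^ 2 / (4 * (1 - β) * k ^ 2) ≤ M := by
    have := Int.le_ceil (Real.pi ^ 2 / (4 * (1 - β) * k ^ 2))
    rwa [hM] at this
  have eK : Real.exp (-(2 * β * k * K)) ≤ E := by
    refine Real.exp_le_exp.2 ?_
    rw [neg_div, neg_le_neg_iff]
    calc _ = 2 * β * k * (Real.pi ^ 2 / (4 * β * k ^ 2)) := by field_simp; ring
      _ ≤ _ := by gcongr
  have eM : Real.exp (-(2 * (1 - β) * k * M)) ≤ E := by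
    refine Real.exp_le_exp.2 ?_
    rw [neg_div, neg_le_neg_iff]
    calc _ = 2 * (1 - β) * k * (Real.pi ^ 2 / (4 * (1 - β) * k ^ 2)) := by field_simp; ring
      _ ≤ _ := by gcongr
  have eS : Real.exp (-(Real.pi ^ 2 / k)) ≤ E := by
    refine Real.exp_le_exp.2 ?_
    rw [neg_div, neg_le_neg_iff]
    gcongr
    linarith
  have hsplit := tsum_int_eq_sum_Icc_add (a := sincTerm β k x) K M
    (summable_sincTerm_nat hβ hk hx0 M) (summable_sincTerm_neg hβ hk hx0 K)
  have t1 := tsum_sincTerm_nat_le hβ hk hx0 M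
  have t2 := tsum_sincTerm_neg_le hβ hk hx0 K
  have p1 : 0 ≤ ∑' n : ℕ, sincTerm β k x ((M + 1 + n : ℕ) : ℤ) :=
    tsum_nonneg fun n => sincTerm_nonneg hx0 _
  have p2 : 0 ≤ ∑' n : ℕ, sincTerm β k x (-((K + 1 + n : ℕ) : ℤ)) :=
    tsum_nonneg fun n => sincTerm_nonneg hx0 _
  set T1 := ∑' n : ℕ, sincTerm β k x ((M + 1 + n : ℕ) : ℤ)
  set T2 := ∑' n : ℕ, sincTerm β k x (-((K + 1 + n : ℕ) : ℤ))
  have hsin : 0 < Real.sin (Real.pi * β) :=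
    Real.sin_pos_of_pos_of_lt_pi (by nlinarith [hβ.1]) (by nlinarith [hβ.2])
  have hsin1 := Real.sin_le_one (Real.pi * β)
  have main := abs_rpow_sub_tsum_sincTerm_le hβ hk hk1 hx0
  rw [hsplit] at main
  have eQ : x ^ (-β) - scalarQuadrature β k x =
      (x ^ (-β) - 2 * k * Real.sin (Real.pi * β) / Real.pi *
        (∑ l ∈ Finset.Icc (-(K : ℤ)) M, sincTerm β k x l + (T1 + T2))) +
      2 * k * Real.sin (Real.pi * β) / Real.pi * (T1 + T2) := by
    rw [scalarQuadrature, hK, hM]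
    ring
  rw [eQ, add_mul]
  refine (abs_add_le _ _).trans (add_le_add (main.trans ?_) ?_)
  · have : x ^ (-β) ≤ x₀ ^ (-β) := Real.rpow_le_rpow_of_nonpos hx₀ hx (by linarith)
    gcongr
  · rw [abs_of_nonneg (by positivity)]
    have hxi : x⁻¹ ≤ x₀⁻¹ := inv_anti₀ hx₀ hx
    calc _ ≤ 2 * k * 1 / 1 * (x₀⁻¹ * ((2 * (1 - β) * k)⁻¹ * E) + (2 * β * k)⁻¹ * E) := by
          gcongr
          · linarith
          · refine t1.trans ?_; gcongr
          · refine t2.trans ?_; gcongr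
      _ = _ := by field_simp

end FracSPDE

end

/-! ### Diagonal form of the numerical approximation. -/

noncomputable section

namespace FracSPDE

variable {H : Type*} [NormedAddCommGroup H] [InnerProductSpace ℝ H]

theorem ringInverse_one_add_smul_apply {V : Type*} [AddCommGroup V] [Module ℝ V]
    {A : Module.End ℝ V} {t x : ℝ} {v : V} (hu : IsUnit (1 + t • A)) (hx : 1 + t * x ≠ 0)
    (hv : A v = x • v) : Ring.inverse (1 + t • A) v = (1 + t * x)⁻¹ • v := by
  have h1 : (1 + t • A) v = (1 + t * x) • v := by
    simp [hv, add_smul, mul_smul]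
  have h2 : Ring.inverse (1 + t • A) ((1 + t • A) v) = v := by
    rw [← Module.End.mul_apply, Ring.inverse_mul_cancel _ hu, Module.End.one_apply]
  rw [h1, map_smul] at h2
  rw [eq_inv_smul_iff₀ hx, h2]

theorem quadrature_apply_eigenvector {V : Type*} [AddCommGroup V] [Module ℝ V]
    {A : Module.End ℝ V} {x : ℝ} {v : V} (hu : ∀ t : ℝ, 0 ≤ t → IsUnit (1 + t • A)) (hx : 0 < x)
    (hv : A v = x • v) (β k : ℝ) : quadrature A β k v = scalarQuadrature β k x • v := by
  rw [quadrature, scalarQuadrature, LinearMap.smul_apply, LinearMap.sum_apply, mul_smul,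
    Finset.sum_smul]
  congr 1
  refine Finset.sum_congr rfl fun l _ => ?_
  rw [LinearMap.smul_apply, ringInverse_one_add_smul_apply (hu _ (Real.exp_pos _).le)
    (by positivity) hv, smul_smul, sincTerm]

/-- `R` is the matrix of `Φ` in the basis `eh`, so the coordinates in `eh` are `R R⁻¹ ξ = ξ`. This
removes all dependence on `Φ`. -/
theorem noiseApprox_eq_sum {V : Submodule ℝ H}
    (eh : OrthonormalBasis (Fin (Module.finrank ℝ V)) ℝ V)
    (Φ : Module.Basis (Fin (Module.finrank ℝ V)) ℝ V)
    {Ω : Type*} (ξ : ℕ → Ω → ℝ) (ω : Ω) :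
    noiseApprox eh Φ ξ ω = ∑ j : Fin (Module.finrank ℝ V), ξ j ω • eh j := by
  set R : Matrix (Fin (Module.finrank ℝ V)) (Fin (Module.finrank ℝ V)) ℝ :=
    Matrix.of fun i j => ⟪eh i, Φ j⟫ with hR
  have hR' : R = eh.toBasis.toMatrix Φ := by
    ext i j
    simp [hR, Module.Basis.toMatrix_apply, OrthonormalBasis.repr_apply_apply]
  have hdet : IsUnit R.det := by
    rw [← Matrix.isUnit_iff_isUnit_det, hR']
    exact IsUnit.of_mul_eq_one_right _ (Module.Basis.toMatrix_mul_toMatrix_flip Φ eh.toBasis)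
  have hmul : R.mulVec (R⁻¹.mulVec fun i => ξ i ω) = fun i : Fin _ => ξ i ω := by
    rw [Matrix.mulVec_mulVec, Matrix.mul_nonsing_inv _ hdet, Matrix.one_mulVec]
  refine (eh.sum_repr' (noiseApprox eh Φ ξ ω)).symm.trans (Finset.sum_congr rfl fun i _ => ?_)
  congr 1
  have : noiseApprox eh Φ ξ ω = ∑ j, (R⁻¹.mulVec fun i => ξ i ω) j • Φ j := rfl
  rw [this, inner_sum]
  simp_rw [real_inner_smul_right]
  refine Eq.trans ?_ (congrFun hmul i)
  exact Finset.sum_congr rfl fun j _ => mul_comm _ _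

theorem approxSolution_eq_sum [CompleteSpace H] {e : HilbertBasis ℕ ℝ H} {lam : ℕ → ℝ}
    {V : Submodule ℝ H} [FiniteDimensional ℝ V] {hV : V ≤ fracDomain e lam (1 / 2)}
    {eh : OrthonormalBasis (Fin (Module.finrank ℝ V)) ℝ V}
    {lamh : Fin (Module.finrank ℝ V) → ℝ} (heh : IsGalerkinEigenbasis e lam V hV eh lamh)
    (hpos : ∀ j, 0 < lamh j)
    (Φ : Module.Basis (Fin (Module.finrank ℝ V)) ℝ V) (β k : ℝ)
    {Ω : Type*} (ξ : ℕ → Ω → ℝ) (g : H) (ω : Ω) :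
    approxSolution e lam V hV eh Φ β k ξ g ω =
      ∑ j, (scalarQuadrature β k (lamh j) * (⟪(eh j : H), g⟫ + ξ j ω)) • (eh j : H) := by
  have h1 : V.orthogonalProjectionOnto g + noiseApprox eh Φ ξ ω =
      ∑ j : Fin (Module.finrank ℝ V), (⟪(eh j : H), g⟫ + ξ j ω) • eh j := by
    rw [noiseApprox_eq_sum]
    simp_rw [add_smul]
    rw [Finset.sum_add_distrib]
    congr 1
    rw [← eh.sum_repr' (V.orthogonalProjectionOnto g)]
    refine Finset.sum_congr rfl fun j _ => ?_
    congr 1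
    exact Submodule.inner_orthogonalProjectionOnto_eq_of_mem_left _ _
  rw [approxSolution, h1, map_sum, Submodule.coe_sum]
  refine Finset.sum_congr rfl fun j _ => ?_
  rw [map_smul, quadrature_apply_eigenvector
    (fun t ht => isUnit_one_add_smul_galerkin e lam V hV ht) (hpos j) (heh.eigen j), smul_smul,
    Submodule.coe_smul, mul_comm]

end FracSPDE

end

/-! ### Series with independent Gaussian coefficients. -/

noncomputable section

namespace FracSPDE

open Filter Topology

variable {H : Type*} [NormedAddCommGroup H] [InnerProductSpace ℝ H]
variable {Ω : Type*} [MeasurableSpace Ω] {μ : Measure Ω} {ξ : ℕ → Ω → ℝ}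

theorem IsStdNormalSeq.memLp (hξ : IsStdNormalSeq μ ξ) (j : ℕ) : MemLp (ξ j) 2 μ := by
  have h : MemLp id 2 (μ.map (ξ j)) := by
    rw [(hξ.1 j).map_eq]
    exact memLp_id_gaussianReal 2
  exact (memLp_map_measure_iff aestronglyMeasurable_id (hξ.1 j).aemeasurable).1 h

theorem IsStdNormalSeq.integral_mul (hξ : IsStdNormalSeq μ ξ) (i j : ℕ) :
    ∫ ω, ξ i ω * ξ j ω ∂μ = if i = j then 1 else 0 := by
  have hmean : ∀ j, ∫ ω, ξ j ω ∂μ = 0 := fun j => by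
    rw [(hξ.1 j).integral_eq, integral_id_gaussianReal]
  split_ifs with h
  · subst h
    have hv := (hξ.1 i).variance_eq
    rw [variance_id_gaussianReal, variance_of_integral_eq_zero (hξ.1 i).aemeasurable (hmean i)] at hv
    simpa [pow_two] using hv
  · rw [(hξ.2.indepFun h).integral_fun_mul_eq_mul_integral
      (hξ.memLp i).aestronglyMeasurable (hξ.memLp j).aestronglyMeasurable, hmean, zero_mul]

theorem IsStdNormalSeq.memLp_sum_smul (hξ : IsStdNormalSeq μ ξ) (x : ℕ → H) (s : Finset ℕ) :
    MemLp (fun ω => ∑ j ∈ s, ξ j ω • x j) 2 μ :=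
  memLp_finsetSum _ fun j _ => (ContinuousLinearMap.toSpanSingleton ℝ (x j)).comp_memLp' (hξ.memLp j)

/-- An isometry of Itô type: the cross terms vanish although the `x j` need not be orthogonal. -/
theorem IsStdNormalSeq.integral_norm_sum_smul_sq (hξ : IsStdNormalSeq μ ξ) (x : ℕ → H)
    (s : Finset ℕ) : ∫ ω, ‖∑ j ∈ s, ξ j ω • x j‖ ^ 2 ∂μ = ∑ j ∈ s, ‖x j‖ ^ 2 := by
  have h1 : ∀ ω, ‖∑ j ∈ s, ξ j ω • x j‖ ^ 2 =
      ∑ i ∈ s, ∑ j ∈ s, ξ i ω * ξ j ω * ⟪x i, x j⟫ := by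
    intro ω
    rw [← real_inner_self_eq_norm_sq, sum_inner]
    refine Finset.sum_congr rfl fun i _ => ?_
    rw [inner_sum]
    refine Finset.sum_congr rfl fun j _ => ?_
    rw [real_inner_smul_left, real_inner_smul_right, mul_assoc]
  have hint : ∀ i j, Integrable (fun ω => ξ i ω * ξ j ω * ⟪x i, x j⟫) μ := fun i j =>
    ((hξ.memLp i).integrable_mul (hξ.memLp j)).mul_const _
  simp_rw [h1]
  rw [integral_finsetSum _ fun i _ => integrable_finsetSum _ fun j _ => hint i j]
  refine Finset.sum_congr rfl fun i hi => ?_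
  rw [integral_finsetSum _ fun j _ => hint i j]
  simp_rw [integral_mul_const, hξ.integral_mul]
  simp [hi]

theorem IsStdNormalSeq.eLpNorm_sum_smul (hξ : IsStdNormalSeq μ ξ) (x : ℕ → H)
    (s : Finset ℕ) : eLpNorm (fun ω => ∑ j ∈ s, ξ j ω • x j) 2 μ =
      ENNReal.ofReal √(∑ j ∈ s, ‖x j‖ ^ 2) := by
  rw [(hξ.memLp_sum_smul x s).eLpNorm_eq_integral_rpow_norm (by norm_num) (by norm_num)]
  congr 1
  simp only [ENNReal.toReal_ofNat, Real.rpow_ofNat]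
  rw [hξ.integral_norm_sum_smul_sq, Real.sqrt_eq_rpow, one_div]

/-- An `L²` bound for series with standard normal coefficients. -/
theorem IsStdNormalSeq.memLp_and_eLpNorm_le_of_tendsto (hξ : IsStdNormalSeq μ ξ) {x : ℕ → H}
    {S : ℝ} (hS : ∀ n, ∑ j ∈ Finset.range n, ‖x j‖ ^ 2 ≤ S) {F : Ω → H}
    (hF : ∀ᵐ ω ∂μ, Tendsto (fun n => ∑ j ∈ Finset.range n, ξ j ω • x j) atTop (𝓝 (F ω))) :
    MemLp F 2 μ ∧ eLpNorm F 2 μ ≤ ENNReal.ofReal √S := by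
  have hm := fun n => (hξ.memLp_sum_smul x (Finset.range n)).aestronglyMeasurable
  have hle : eLpNorm F 2 μ ≤ ENNReal.ofReal √S := by
    -- Fatou: the `L²` norm of the limit inherits the bound on the partial sums.
    refine Lp.eLpNorm_le_of_ae_tendsto (u := atTop) (Eventually.of_forall fun n => ?_) hm hF
    rw [hξ.eLpNorm_sum_smul]
    exact ENNReal.ofReal_le_ofReal (Real.sqrt_le_sqrt (hS n))
  exact ⟨⟨aestronglyMeasurable_of_tendsto_ae atTop hm hF, hle.trans_lt ENNReal.ofReal_lt_top⟩, hle⟩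

/-- The expectation of `∑ a_j² ξ_j²` is `∑ a_j²`, finite, so the sum is finite almost surely. -/
theorem IsStdNormalSeq.ae_summable_sq (hξ : IsStdNormalSeq μ ξ) {a : ℕ → ℝ}
    (ha : Summable fun j => a j ^ 2) : ∀ᵐ ω ∂μ, Summable fun j => (a j * ξ j ω) ^ 2 := by
  have hint : ∀ j, Integrable (fun ω => (a j * ξ j ω) ^ 2) μ := fun j =>
    ((hξ.memLp j).const_mul (a j)).integrable_sq
  have h1 : ∫⁻ ω, ∑' j, ENNReal.ofReal ((a j * ξ j ω) ^ 2) ∂μ =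
      ∑' j, ENNReal.ofReal (a j ^ 2) := by
    rw [lintegral_tsum fun j => (hint j).aemeasurable.ennreal_ofReal]
    congr 1
    ext j
    rw [← ofReal_integral_eq_lintegral_ofReal (hint j) (ae_of_all _ fun ω => sq_nonneg _)]
    congr 1
    simp_rw [mul_pow, pow_two (ξ j _)]
    rw [integral_const_mul, hξ.integral_mul, if_pos rfl, mul_one]
  have h2 : ∫⁻ ω, ∑' j, ENNReal.ofReal ((a j * ξ j ω) ^ 2) ∂μ ≠ ⊤ := by
    rw [h1]
    exact ha.tsum_ofReal_ne_top
  have h3 := ae_lt_top' (AEMeasurable.tsum fun j =>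
    (hint j).aemeasurable.ennreal_ofReal) h2
  filter_upwards [h3] with ω hω
  refine (ENNReal.summable_toReal hω.ne).congr fun j => ?_
  rw [ENNReal.toReal_ofReal (sq_nonneg _)]

end FracSPDE

end

/-! ### Existence, uniqueness and the abstract error bound. -/

noncomputable section

namespace FracSPDE

open Filter Topology

variable {H : Type*} [NormedAddCommGroup H] [InnerProductSpace ℝ H]
variable {Ω : Type*} [MeasurableSpace Ω] {μ : Measure Ω} {ξ : ℕ → Ω → ℝ}

theorem hasSum_smul_basis (e : HilbertBasis ℕ ℝ H) {a : ℕ → ℝ} (ha : Summable fun j => a j ^ 2) :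
    HasSum (fun j => a j • e j) (∑' j, a j • e j) :=
  (e.hasSum_repr_symm ⟨a, memlp_of_summable_sq ha⟩).summable.hasSum

theorem inner_tsum_smul_basis (e : HilbertBasis ℕ ℝ H) {a : ℕ → ℝ}
    (ha : Summable fun j => a j ^ 2) (i : ℕ) : ⟪e i, ∑' j, a j • e j⟫ = a i := by
  have h := e.hasSum_repr_symm ⟨a, memlp_of_summable_sq ha⟩
  have h2 : ∑' j, a j • e j = e.repr.symm ⟨a, memlp_of_summable_sq ha⟩ := h.tsum_eq
  rw [h2, ← e.repr_apply_apply, LinearIsometryEquiv.apply_symm_apply]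

theorem inner_fracPow (e : HilbertBasis ℕ ℝ H) (lam : ℕ → ℝ) (β : ℝ)
    (φ : (fracPow e lam β).domain) (j : ℕ) :
    ⟪e j, fracPow e lam β φ⟫ = lam j ^ β * ⟪e j, (φ : H)⟫ := by
  have h2 : fracPow e lam β φ =
    e.repr.symm ⟨fun j => lam j ^ β * ⟪e j, (φ : H)⟫, memlp_of_summable_sq φ.2⟩ := rfl
  rw [h2, ← e.repr_apply_apply, LinearIsometryEquiv.apply_symm_apply]

theorem basis_mem_fracDomain (e : HilbertBasis ℕ ℝ H) (lam : ℕ → ℝ) (β : ℝ) (i : ℕ) :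
    e i ∈ fracDomain e lam β := by
  change Summable fun j => (lam j ^ β * ⟪e j, e i⟫) ^ 2
  refine summable_of_ne_finset_zero (s := {i}) fun j hj => ?_
  rw [Finset.mem_singleton] at hj
  rw [e.orthonormal.2 hj]
  simp

theorem ext_inner_basis (e : HilbertBasis ℕ ℝ H) {x y : H} (h : ∀ j, ⟪e j, x⟫ = ⟪e j, y⟫) :
    x = y := by
  apply e.repr.injective
  ext j
  rw [e.repr_apply_apply, e.repr_apply_apply, h j]

theorem summable_mul_inner_sq (e : HilbertBasis ℕ ℝ H) {a : ℕ → ℝ}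
    (ha : Summable fun j => a j ^ 2) (g : H) : Summable fun j => (a j * ⟪e j, g⟫) ^ 2 := by
  refine Summable.of_nonneg_of_le (fun j => sq_nonneg _) (fun j => ?_) (ha.mul_right (‖g‖ ^ 2))
  rw [mul_pow]
  refine mul_le_mul_of_nonneg_left (sq_le_sq.2 ?_) (sq_nonneg _)
  simpa [e.orthonormal.1 j] using abs_real_inner_le_norm (e j) g

/-- The series `∑_j a_j (ξ_j + ⟪e_j, g⟫) e_j`; for `a_j = lam_j ^ (-β)` it solves
`L^β u = g + W`. -/
def seriesSolution (e : HilbertBasis ℕ ℝ H) (a : ℕ → ℝ) (ξ : ℕ → Ω → ℝ) (g : H) (ω : Ω) : H :=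
  ∑' j, (a j * ξ j ω) • e j + ∑' j, (a j * ⟪e j, g⟫) • e j

theorem memLp_seriesSolution [IsProbabilityMeasure μ] (hξ : IsStdNormalSeq μ ξ)
    (e : HilbertBasis ℕ ℝ H) {a : ℕ → ℝ} (ha : Summable fun j => a j ^ 2) (g : H) :
    MemLp (seriesSolution e a ξ g) 2 μ := by
  refine MemLp.add ?_ (memLp_const (∑' j, (a j * ⟪e j, g⟫) • e j))
  refine (hξ.memLp_and_eLpNorm_le_of_tendsto (x := fun j => a j • e j) (S := ∑' j, a j ^ 2)
    (fun n => ?_) ?_).1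
  · simp_rw [norm_smul, e.orthonormal.1, mul_one, Real.norm_eq_abs, sq_abs]
    exact ha.sum_le_tsum _ fun j _ => sq_nonneg _
  -- Off this event the `tsum` may take its default value `0`, which only affects a null set.
  · filter_upwards [hξ.ae_summable_sq ha] with ω hω
    refine ((hasSum_smul_basis e hω).tendsto_sum_nat).congr fun n => ?_
    refine Finset.sum_congr rfl fun j _ => ?_
    rw [smul_smul, mul_comm]

theorem isSolution_seriesSolution (hξ : IsStdNormalSeq μ ξ)
    (e : HilbertBasis ℕ ℝ H) {lam : ℕ → ℝ} {β : ℝ} (hlam : ∀ j, 0 < lam j)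
    (ha : Summable fun j => (lam j ^ (-β)) ^ 2) (g : H) :
    IsSolution e lam β μ ξ g (seriesSolution e (fun j => lam j ^ (-β)) ξ g) := by
  filter_upwards [hξ.ae_summable_sq ha] with ω hω φ
  have h := e.hasSum_inner_mul_inner
    (seriesSolution e (fun j => lam j ^ (-β)) ξ g ω) (fracPow e lam β φ)
  refine (h.sub (e.hasSum_inner_mul_inner g (φ : H))).congr_fun ?_
  intro j
  have hc : lam j ^ (-β) * lam j ^ β = 1 := by rw [← Real.rpow_add (hlam j)]; simp
  have hu : ⟪seriesSolution e (fun j => lam j ^ (-β)) ξ g ω, e j⟫ =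
      lam j ^ (-β) * ξ j ω + lam j ^ (-β) * ⟪e j, g⟫ := by
    rw [real_inner_comm, seriesSolution, inner_add_right, inner_tsum_smul_basis e hω,
      inner_tsum_smul_basis e (summable_mul_inner_sq e ha g)]
  rw [hu, inner_fracPow, real_inner_comm (e j) g]
  linear_combination (-ξ j ω * ⟪e j, (φ : H)⟫ - ⟪e j, g⟫ * ⟪e j, (φ : H)⟫) * hc

/-- Testing with `φ = e_j` leaves a single term of the noise and determines the `j`-th coefficient.
-/
theorem IsSolution.inner_eq {e : HilbertBasis ℕ ℝ H} {lam : ℕ → ℝ} {β : ℝ} {g : H} {v : Ω → H}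
    (hlam : ∀ j, 0 < lam j) (hv : IsSolution e lam β μ ξ g v) :
    ∀ᵐ ω ∂μ, ∀ j, ⟪e j, v ω⟫ = lam j ^ (-β) * (ξ j ω + ⟪e j, g⟫) := by
  filter_upwards [hv] with ω hω j
  have h := hω ⟨e j, basis_mem_fracDomain e lam β j⟩
  have h1 : HasSum (fun i => ξ i ω * ⟪e i, e j⟫) (ξ j ω) := by
    have := hasSum_single (f := fun i => ξ i ω * ⟪e i, e j⟫) j fun i hi => by
      rw [e.orthonormal.2 hi, mul_zero]
    simpa [e.orthonormal.1 j] using this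
  have h2 := h.unique h1
  have h3 : fracPow e lam β ⟨e j, basis_mem_fracDomain e lam β j⟩ = lam j ^ β • e j := by
    refine ext_inner_basis e fun i => ?_
    rw [inner_fracPow, real_inner_smul_right]
    by_cases hij : i = j
    · rw [hij]
    · rw [e.orthonormal.2 hij, mul_zero, mul_zero]
  rw [h3, real_inner_smul_right] at h2
  have hc : lam j ^ (-β) * lam j ^ β = 1 := by rw [← Real.rpow_add (hlam j)]; simp
  rw [real_inner_comm (v ω), real_inner_comm g]
  have h4 : ⟪e j, v ω⟫ = ⟪v ω, e j⟫ := real_inner_comm _ _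
  linear_combination lam j ^ (-β) * h2 - ⟪v ω, e j⟫ * hc

theorem IsSolution.ae_eq {e : HilbertBasis ℕ ℝ H} {lam : ℕ → ℝ} {β : ℝ} {g : H} {u v : Ω → H}
    (hlam : ∀ j, 0 < lam j) (hu : IsSolution e lam β μ ξ g u) (hv : IsSolution e lam β μ ξ g v) :
    v =ᵐ[μ] u := by
  filter_upwards [hu.inner_eq hlam, hv.inner_eq hlam] with ω h1 h2
  exact ext_inner_basis e fun j => by rw [h1, h2]

/-- Error of a truncated perturbed expansion, in terms of Hilbert-Schmidt type sums. -/
theorem eLpNorm_seriesSolution_sub_le [IsProbabilityMeasure μ] (hξ : IsStdNormalSeq μ ξ)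
    (e : HilbertBasis ℕ ℝ H) {a b : ℕ → ℝ} (ha : Summable fun j => a j ^ 2) (g : H) {N : ℕ}
    {f : ℕ → H} (hf : Orthonormal ℝ fun j : Fin N => f j) (hb : ∀ j, N ≤ j → b j = 0)
    {S T : ℝ} (hS : ∀ n, ∑ j ∈ Finset.range n, ‖a j • e j - b j • f j‖ ^ 2 ≤ S)
    (hT : ∑ j ∈ Finset.range N, b j ^ 2 * ‖e j - f j‖ ^ 2 ≤ T) :
    eLpNorm (fun ω => seriesSolution e a ξ g ω -
        ∑ j ∈ Finset.range N, (b j * (⟪f j, g⟫ + ξ j ω)) • f j) 2 μ ≤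
      ENNReal.ofReal (√S + (√S + √T) * ‖g‖) := by
  have htail : ∀ (c : ℕ → ℝ) n, N ≤ n → ∑ j ∈ Finset.range n, (c j * b j) • f j =
      ∑ j ∈ Finset.range N, (c j * b j) • f j := by
    intro c n hn
    refine (Finset.sum_subset (Finset.range_mono hn) fun j _ hj => ?_).symm
    rw [hb j (by simpa using hj), mul_zero, zero_smul]
  have hconv : ∀ c : ℕ → ℝ, (Summable fun j => (a j * c j) ^ 2) →
      Tendsto (fun n => ∑ j ∈ Finset.range n, c j • (a j • e j - b j • f j)) atTop
        (𝓝 (∑' j, (a j * c j) • e j - ∑ j ∈ Finset.range N, (c j * b j) • f j)) := by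
    intro c hc
    refine ((hasSum_smul_basis e hc).tendsto_sum_nat.sub_const _).congr' ?_
    filter_upwards [eventually_ge_atTop N] with n hn
    rw [← htail c n hn, ← Finset.sum_sub_distrib]
    refine Finset.sum_congr rfl fun j _ => ?_
    rw [smul_sub, smul_smul, smul_smul, mul_comm]
  have hstoch := (hξ.memLp_and_eLpNorm_le_of_tendsto hS (F := fun ω =>
    ∑' j, (a j * ξ j ω) • e j - ∑ j ∈ Finset.range N, (ξ j ω * b j) • f j) (by
      filter_upwards [hξ.ae_summable_sq ha] with ω hω
      exact hconv (fun j => ξ j ω) hω))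
  -- The load error is split so that `D1` uses the coefficients `⟪e_j, g⟫` in both expansions; `D2`
  -- accounts for replacing `⟪f_j, g⟫` by `⟪e_j, g⟫`. Cauchy-Schwarz with Bessel bounds `D1`,
  -- orthonormality of `f` bounds `D2`.
  set D1 : H := ∑' j, (a j * ⟪e j, g⟫) • e j - ∑ j ∈ Finset.range N, (⟪e j, g⟫ * b j) • f j with hD1
  set D2 : H := ∑ j ∈ Finset.range N, (b j * ⟪e j - f j, g⟫) • f j with hD2
  have hD1le : ‖D1‖ ≤ √S * ‖g‖ := by
    refine le_of_tendsto (hconv (fun j => ⟪e j, g⟫) (summable_mul_inner_sq e ha g)).norm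
      (Eventually.of_forall fun n => ?_)
    calc _ ≤ ∑ j ∈ Finset.range n, ‖a j • e j - b j • f j‖ * |⟪e j, g⟫| := by
          refine (norm_sum_le _ _).trans_eq (Finset.sum_congr rfl fun j _ => ?_)
          rw [norm_smul, Real.norm_eq_abs, mul_comm]
      _ ≤ √(∑ j ∈ Finset.range n, ‖a j • e j - b j • f j‖ ^ 2) *
          √(∑ j ∈ Finset.range n, |⟪e j, g⟫| ^ 2) := Real.sum_mul_le_sqrt_mul_sqrt _ _ _
      _ ≤ √S * √(‖g‖ ^ 2) := by
          gcongr
          · exact hS n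
          · exact e.orthonormal.sum_inner_products_le g
      _ = _ := by rw [Real.sqrt_sq (norm_nonneg _)]
  have hD2le : ‖D2‖ ≤ √T * ‖g‖ := by
    rw [← Real.sqrt_sq (norm_nonneg g), ← Real.sqrt_mul' _ (sq_nonneg _)]
    refine Real.le_sqrt_of_sq_le ?_
    have : ‖D2‖ ^ 2 = ∑ j ∈ Finset.range N, (b j * ⟪e j - f j, g⟫) ^ 2 := by
      rw [hD2, Finset.sum_range fun j => (b j * ⟪e j - f j, g⟫) • f j,
        Finset.sum_range fun j => (b j * ⟪e j - f j, g⟫) ^ 2, ← real_inner_self_eq_norm_sq,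
        hf.inner_sum]
      simp [pow_two]
    rw [this]
    calc _ ≤ ∑ j ∈ Finset.range N, b j ^ 2 * ‖e j - f j‖ ^ 2 * ‖g‖ ^ 2 := by
          refine Finset.sum_le_sum fun j _ => ?_
          rw [mul_pow, mul_assoc, ← mul_pow ‖e j - f j‖]
          gcongr ?_ * ?_
          rw [← sq_abs]
          gcongr
          exact abs_real_inner_le_norm _ _
      _ ≤ _ := by
          rw [← Finset.sum_mul]
          gcongr
  have hsplit : (fun ω => seriesSolution e a ξ g ω -
      ∑ j ∈ Finset.range N, (b j * (⟪f j, g⟫ + ξ j ω)) • f j) =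
      (fun ω => ∑' j, (a j * ξ j ω) • e j - ∑ j ∈ Finset.range N, (ξ j ω * b j) • f j) +
        fun _ => D1 + D2 := by
    ext ω
    simp only [Pi.add_apply, seriesSolution, hD1, hD2]
    have : ∑ j ∈ Finset.range N, (b j * (⟪f j, g⟫ + ξ j ω)) • f j =
        ∑ j ∈ Finset.range N, (ξ j ω * b j) • f j + (∑ j ∈ Finset.range N, (⟪e j, g⟫ * b j) • f j -
          ∑ j ∈ Finset.range N, (b j * ⟪e j - f j, g⟫) • f j) := by
      rw [← Finset.sum_sub_distrib, ← Finset.sum_add_distrib]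
      refine Finset.sum_congr rfl fun j _ => ?_
      rw [← sub_smul, ← add_smul, inner_sub_left]
      congr 1
      ring
    rw [this]
    abel
  rw [hsplit]
  refine (eLpNorm_add_le hstoch.1.aestronglyMeasurable aestronglyMeasurable_const
    (by norm_num)).trans ?_
  rw [ENNReal.ofReal_add (by positivity) (by positivity)]
  refine add_le_add hstoch.2 ?_
  rw [eLpNorm_const _ (by norm_num) (IsProbabilityMeasure.ne_zero μ), measure_univ,
    ENNReal.one_rpow, mul_one, ← ofReal_norm]
  refine ENNReal.ofReal_le_ofReal ((norm_add_le _ _).trans ?_)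
  linarith

end FracSPDE

end

/-! ### Power sums and powers of eigenvalues. -/

noncomputable section

namespace FracSPDE

/-- Concavity of `t ^ p`, as Bernoulli's inequality at `-1/(n+1)`. Telescoping then replaces
comparison with an integral. -/
theorem mul_add_one_rpow_sub_one_le {p : ℝ} (hp0 : 0 < p) (hp1 : p ≤ 1) (n : ℕ) :
    p * ((n : ℝ) + 1) ^ (p - 1) ≤ ((n : ℝ) + 1) ^ p - (n : ℝ) ^ p := by
  have hn : (0 : ℝ) < (n : ℝ) + 1 := by positivity
  have h := rpow_one_add_le_one_add_mul_self (s := -1 / ((n : ℝ) + 1))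
    (by rw [neg_div, neg_le_neg_iff, div_le_one hn]; linarith [(Nat.cast_nonneg n : (0:ℝ) ≤ n)])
    hp0.le hp1
  have e1 : 1 + -1 / ((n : ℝ) + 1) = n / (n + 1) := by field_simp; ring
  rw [e1, Real.div_rpow (Nat.cast_nonneg n) hn.le, div_le_iff₀ (by positivity)] at h
  rw [Real.rpow_sub_one hn.ne']
  calc _ = ((n : ℝ) + 1) ^ p - (1 + p * (-1 / ((n : ℝ) + 1))) * ((n : ℝ) + 1) ^ p := by
        field_simp; ring
    _ ≤ _ := by linarith

theorem sum_range_rpow_sub_one_le {p : ℝ} (hp0 : 0 < p) (hp1 : p ≤ 1) (N : ℕ) :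
    ∑ j ∈ Finset.range N, ((j : ℝ) + 1) ^ (p - 1) ≤ p⁻¹ * (N : ℝ) ^ p := by
  induction N with
  | zero => simp [Real.zero_rpow hp0.ne']
  | succ n ih =>
    rw [Finset.sum_range_succ]
    have h := mul_add_one_rpow_sub_one_le hp0 hp1 n
    rw [← le_inv_mul_iff₀ hp0] at h
    push_cast
    linarith [mul_sub p⁻¹ (((n : ℝ) + 1) ^ p) ((n : ℝ) ^ p)]

/-- For `δ = 0` the series converges; for `δ > 0` and `γ < 0` the exponent is raised to `min δ 1 -
1`; for `γ ≥ 0` each term is at most `N ^ γ`. The excluded pair is the harmonic sum. -/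
theorem exists_sum_range_rpow_le {γ δ : ℝ} (hδ : 0 ≤ δ) (hγ : γ + 1 ≤ δ)
    (hcrit : ¬ (γ = -1 ∧ δ = 0)) :
    ∃ C : ℝ, 0 < C ∧ ∀ N : ℕ, 1 ≤ N →
      ∑ j ∈ Finset.range N, ((j : ℝ) + 1) ^ γ ≤ C * (N : ℝ) ^ δ := by
  rcases hδ.eq_or_lt with h0 | hδ
  · have hγ1 : γ < -1 := lt_of_le_of_ne (by linarith) fun h => hcrit ⟨h, h0.symm⟩
    have hs : Summable fun j : ℕ => ((j : ℝ) + 1) ^ γ := by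
      have := (summable_nat_add_iff 1).2 (Real.summable_nat_rpow.2 hγ1)
      simpa using this
    refine ⟨∑' j : ℕ, ((j : ℝ) + 1) ^ γ, hs.tsum_pos (fun j => by positivity) 0 (by simp), ?_⟩
    intro N _
    rw [← h0, Real.rpow_zero, mul_one]
    exact hs.sum_le_tsum _ fun j _ => by positivity
  · rcases lt_or_ge γ 0 with hneg | hpos
    · have hp : 0 < min δ 1 := lt_min hδ one_pos
      refine ⟨(min δ 1)⁻¹, by positivity, fun N hN => ?_⟩
      have hN' : (1 : ℝ) ≤ N := by exact_mod_cast hN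
      calc _ ≤ ∑ j ∈ Finset.range N, ((j : ℝ) + 1) ^ (min δ 1 - 1) := by
            refine Finset.sum_le_sum fun j _ => ?_
            refine Real.rpow_le_rpow_of_exponent_le (by linarith [(Nat.cast_nonneg j : (0:ℝ) ≤ j)]) ?_
            rw [le_sub_iff_add_le, le_min_iff]
            exact ⟨hγ, by linarith⟩
        _ ≤ (min δ 1)⁻¹ * (N : ℝ) ^ (min δ 1) := sum_range_rpow_sub_one_le hp (min_le_right _ _) N
        _ ≤ _ := by
            gcongr
            exact min_le_left _ _
    · refine ⟨1, one_pos, fun N hN => ?_⟩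
      have hN' : (1 : ℝ) ≤ N := by exact_mod_cast hN
      calc _ ≤ ∑ j ∈ Finset.range N, (N : ℝ) ^ γ := by
            refine Finset.sum_le_sum fun j hj => ?_
            refine Real.rpow_le_rpow (by positivity) ?_ hpos
            exact_mod_cast Finset.mem_range.1 hj
        _ = (N : ℝ) ^ (γ + 1) := by
            rw [Finset.sum_const, Finset.card_range, nsmul_eq_mul, Real.rpow_add_one (by positivity),
              mul_comm]
        _ ≤ _ := by
            rw [one_mul]
            exact Real.rpow_le_rpow_of_exponent_le hN' hγ

theorem mul_add_one_rpow_neg_le {p : ℝ} (hp : 0 < p) {n : ℕ} (hn : 1 ≤ n) :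
    p * ((n : ℝ) + 1) ^ (-p - 1) ≤ (n : ℝ) ^ (-p) - ((n : ℝ) + 1) ^ (-p) := by
  have hn0 : (0 : ℝ) < n := by exact_mod_cast hn
  have hn1 : (0 : ℝ) < (n : ℝ) + 1 := by positivity
  have h1 : (n : ℝ) / (n + 1) ≤ Real.exp (-(1 / ((n : ℝ) + 1))) := by
    have := Real.add_one_le_exp (-(1 / ((n : ℝ) + 1)))
    refine le_trans (le_of_eq ?_) this
    field_simp; ring
  have h2 : 1 + p / ((n : ℝ) + 1) ≤ ((n : ℝ) / (n + 1)) ^ (-p) := by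
    calc _ ≤ Real.exp (p / ((n : ℝ) + 1)) := by linarith [Real.add_one_le_exp (p / ((n : ℝ) + 1))]
      _ = Real.exp (-(1 / ((n : ℝ) + 1))) ^ (-p) := by
          rw [← Real.exp_mul]; congr 1; ring
      _ ≤ _ := Real.rpow_le_rpow_of_nonpos (by positivity) h1 (by linarith)
  rw [Real.div_rpow hn0.le hn1.le, le_div_iff₀ (by positivity)] at h2
  rw [Real.rpow_sub_one hn1.ne']
  calc _ = (1 + p / ((n : ℝ) + 1)) * ((n : ℝ) + 1) ^ (-p) - ((n : ℝ) + 1) ^ (-p) := by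
        field_simp; ring
    _ ≤ _ := by linarith

theorem sum_Ico_rpow_le {p : ℝ} (hp : 0 < p) {N n : ℕ} (hN : 1 ≤ N) (hn : N ≤ n) :
    ∑ j ∈ Finset.Ico N n, ((j : ℝ) + 1) ^ (-p - 1) ≤ p⁻¹ * (N : ℝ) ^ (-p) := by
  have key : ∑ j ∈ Finset.Ico N n, ((j : ℝ) + 1) ^ (-p - 1) ≤
      p⁻¹ * ((N : ℝ) ^ (-p) - (n : ℝ) ^ (-p)) := by
    induction n, hn using Nat.le_induction with
    | base => simp
    | succ n hn ih =>
      rw [Finset.sum_Ico_succ_top hn]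
      have h := mul_add_one_rpow_neg_le hp (hN.trans hn)
      rw [← le_inv_mul_iff₀ hp] at h
      push_cast
      linarith [mul_sub p⁻¹ ((n : ℝ) ^ (-p)) (((n : ℝ) + 1) ^ (-p)),
        mul_sub p⁻¹ ((N : ℝ) ^ (-p)) ((n : ℝ) ^ (-p)),
        mul_sub p⁻¹ ((N : ℝ) ^ (-p)) (((n : ℝ) + 1) ^ (-p))]
  refine key.trans ?_
  gcongr
  linarith [Real.rpow_nonneg (Nat.cast_nonneg n : (0:ℝ) ≤ n) (-p)]

/-- Powers of eigenvalues with algebraic growth. -/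
theorem EigenvalueGrowth.exists_rpow_le {lam : ℕ → ℝ} {α : ℝ} (h : EigenvalueGrowth lam α) (p : ℝ) :
    ∃ C : ℝ, 0 < C ∧ ∀ j : ℕ, lam j ^ p ≤ C * ((j : ℝ) + 1) ^ (α * p) := by
  obtain ⟨c, C, hc, hC, hb⟩ := h
  have hj : ∀ j : ℕ, (0 : ℝ) < (j : ℝ) + 1 := fun j => by positivity
  rcases le_total 0 p with hp | hp
  · refine ⟨C ^ p, by positivity, fun j => ?_⟩
    rw [Real.rpow_mul (hj j).le, ← Real.mul_rpow hC.le (by positivity)]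
    exact Real.rpow_le_rpow ((by positivity : (0:ℝ) ≤ c * ((j : ℝ) + 1) ^ α).trans (hb j).1)
      (hb j).2 hp
  · refine ⟨c ^ p, by positivity, fun j => ?_⟩
    rw [Real.rpow_mul (hj j).le, ← Real.mul_rpow hc.le (by positivity)]
    exact Real.rpow_le_rpow_of_nonpos (by positivity) (hb j).1 hp

theorem EigenvalueGrowth.pos {lam : ℕ → ℝ} {α : ℝ} (h : EigenvalueGrowth lam α) (j : ℕ) :
    0 < lam j := by
  obtain ⟨c, C, hc, hC, hb⟩ := h
  exact lt_of_lt_of_le (by positivity) (hb j).1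

/-- Mean value type bound for negative fractional powers. -/
theorem abs_rpow_neg_sub_rpow_neg_le {β x y : ℝ} (hβ0 : 0 < β) (hβ1 : β < 1) (hx : 0 < x)
    (hxy : x ≤ y) : |x ^ (-β) - y ^ (-β)| ≤ x ^ (-β - 1) * (y - x) := by
  have hy := hx.trans_le hxy
  have h1 : y ^ (-β) ≤ x ^ (-β) := Real.rpow_le_rpow_of_nonpos hx hxy (by linarith)
  rw [abs_of_nonneg (by linarith), Real.rpow_sub_one hx.ne']
  -- Here `x / y ≤ 1` and `β < 1`; this reduces the estimate to a linear one without
  -- differentiation.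
  have h2 : x / y ≤ (x / y) ^ β := by
    conv_lhs => rw [← Real.rpow_one (x / y)]
    exact Real.rpow_le_rpow_of_exponent_ge (by positivity) ((div_le_one hy).2 hxy) hβ1.le
  have h3 : y ^ (-β) = x ^ (-β) * (x / y) ^ β := by
    rw [Real.div_rpow hx.le hy.le, Real.rpow_neg hx.le, Real.rpow_neg hy.le]
    field_simp
  have h4 : 1 - (y - x) / x ≤ x / y := by
    rw [sub_le_iff_le_add, div_add_div _ _ hy.ne' hx.ne', le_div_iff₀ (by positivity)]
    nlinarith [sq_nonneg (y - x)]
  have hxp : 0 < x ^ (-β) := by positivity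
  rw [h3]
  calc _ = x ^ (-β) * (1 - (x / y) ^ β) := by ring
    _ ≤ x ^ (-β) * ((y - x) / x) := by gcongr; linarith
    _ = _ := by ring

end FracSPDE

end

/-! ### Summing the four error contributions. -/

noncomputable section

namespace FracSPDE

variable {H : Type*} [NormedAddCommGroup H] [InnerProductSpace ℝ H]

/-- Inserting `c = lamh ^ (-β)` separates the eigenvector, eigenvalue and quadrature errors. The
factor `3` would do for `η ^ 2` too; `8` lets the next lemma share the right-hand side. -/
theorem norm_smul_sub_smul_sq_le {x y : H} (hy : ‖y‖ = 1) {a b c η : ℝ} (hη : |c - b| ≤ η) :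
    ‖a • x - b • y‖ ^ 2 ≤ 3 * (a ^ 2 * ‖x - y‖ ^ 2) + 3 * (a - c) ^ 2 + 8 * η ^ 2 := by
  have h1 : a • x - b • y = a • (x - y) + ((a - c) • y + (c - b) • y) := by
    rw [smul_sub, sub_smul, sub_smul]; abel
  have h2 : ‖a • x - b • y‖ ≤ |a| * ‖x - y‖ + (|a - c| + |c - b|) := by
    rw [h1]
    refine (norm_add_le_of_le le_rfl (norm_add_le _ _)).trans_eq ?_
    simp [norm_smul, hy]
  have h3 : ‖a • x - b • y‖ ^ 2 ≤ (|a| * ‖x - y‖ + (|a - c| + η)) ^ 2 := by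
    gcongr
    linarith
  rw [← sq_abs a, ← sq_abs (a - c)]
  nlinarith [sq_nonneg (|a| * ‖x - y‖ - |a - c|), sq_nonneg (|a| * ‖x - y‖ - η),
    sq_nonneg (|a - c| - η), sq_nonneg η]

theorem sq_mul_norm_sub_sq_le {E : Type*} [NormedAddCommGroup E] {x y : E} (hx : ‖x‖ = 1) (hy : ‖y‖ = 1) {a b c η : ℝ}
    (hη : |c - b| ≤ η) (hc : 0 ≤ c) (hca : c ≤ a) :
    b ^ 2 * ‖x - y‖ ^ 2 ≤ 3 * (a ^ 2 * ‖x - y‖ ^ 2) + 3 * (a - c) ^ 2 + 8 * η ^ 2 := by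
  have h1 : ‖x - y‖ ≤ 2 := (norm_sub_le x y).trans (by rw [hx, hy]; norm_num)
  have h2 : ‖x - y‖ ^ 2 ≤ 2 ^ 2 := by gcongr
  have h3 : |b| ≤ a + η := by
    have := abs_sub_abs_le_abs_sub b c
    rw [abs_sub_comm, abs_of_nonneg hc] at this
    linarith
  have h4 : b ^ 2 ≤ 2 * a ^ 2 + 2 * η ^ 2 := by
    have : b ^ 2 ≤ (a + η) ^ 2 := sq_le_sq' (by linarith [(abs_le.1 h3).1]) (abs_le.1 h3).2
    nlinarith [sq_nonneg (a - η)]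
  have h5 : b ^ 2 * ‖x - y‖ ^ 2 ≤ (2 * a ^ 2 + 2 * η ^ 2) * ‖x - y‖ ^ 2 := by gcongr
  have h6 : η ^ 2 * ‖x - y‖ ^ 2 ≤ η ^ 2 * 2 ^ 2 := by gcongr
  have h7 : 0 ≤ a ^ 2 * ‖x - y‖ ^ 2 := by positivity
  nlinarith [sq_nonneg (a - c)]

/-- Power sums up to the dimension `N ≲ h ^ (-d)`, absorbed into a power of `h`. -/
theorem exists_rpow_mul_sum_range_le {γ t ρ d c : ℝ} (hd : 0 < d) (hc : 0 < c) (hρ : ρ ≤ t)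
    (hγ : d * (γ + 1) ≤ 2 * t - 2 * ρ) (hcrit : ¬ (γ = -1 ∧ ρ = t)) :
    ∃ C : ℝ, 0 < C ∧ ∀ (h : ℝ) (N : ℕ), 0 < h → 1 ≤ N → (N : ℝ) ≤ c * h ^ (-d) →
      h ^ (2 * t) * ∑ j ∈ Finset.range N, ((j : ℝ) + 1) ^ γ ≤ C * h ^ (2 * ρ) := by
  -- Chosen so that `N ≤ c h^(-d)` gives `N ^ δ ≤ c ^ δ h^(2ρ - 2t)`.
  set δ := (2 * t - 2 * ρ) / d with hδ
  have hδ0 : 0 ≤ δ := div_nonneg (by linarith) hd.le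
  obtain ⟨C, hC, hb⟩ := exists_sum_range_rpow_le (γ := γ) (δ := δ) hδ0
    (by rw [hδ, le_div_iff₀ hd]; linarith) (by
      rintro ⟨h1, h2⟩
      refine hcrit ⟨h1, ?_⟩
      rw [hδ, div_eq_zero_iff] at h2
      rcases h2 with h2 | h2 <;> linarith)
  refine ⟨C * c ^ δ, by positivity, fun h N hh hN hNle => ?_⟩
  have e : h ^ (-d * δ) = h ^ (2 * ρ - 2 * t) := by
    congr 1; rw [hδ]; field_simp; ring
  calc _ ≤ h ^ (2 * t) * (C * (c * h ^ (-d)) ^ δ) := by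
        gcongr
        refine (hb N hN).trans ?_
        gcongr
    _ = C * c ^ δ * (h ^ (2 * t) * h ^ (-d * δ)) := by
        rw [Real.mul_rpow hc.le (by positivity), ← Real.rpow_mul hh.le]; ring
    _ = _ := by
        rw [e, ← Real.rpow_add hh]; congr 2; ring

set_option maxHeartbeats 1000000 in
-- Supplies both sums required by `eLpNorm_seriesSolution_sub_le`: below the dimension, one majorant
-- `U j` serves for both; beyond it, only `lam j ^ (-2β)` is left.
theorem exists_error_sums_le {e : HilbertBasis ℕ ℝ H} {lam : ℕ → ℝ}
    {V : Set.Ioo (0 : ℝ) 1 → Submodule ℝ H}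
    {eh : ∀ h, OrthonormalBasis (Fin (Module.finrank ℝ (V h))) ℝ (V h)}
    {lamh : ∀ h, Fin (Module.finrank ℝ (V h)) → ℝ}
    {d : ℕ} {h₀ C₁ C₂ r s q : ℝ} (hFE : FEAssumption e lam V eh lamh d h₀ C₁ C₂ r s q)
    {α β : ℝ} (hβ : β ∈ Set.Ioo (0 : ℝ) 1) (hgrowth : EigenvalueGrowth lam α)
    (hα_lower : 1 / (2 * β) < α)
    (hα_upper : α ≤ min (r / ((q - 1) * d)) (2 * s / (q * d)))
    (hcrit_r : ¬ (α = r / ((q - 1) * d) ∧ d * (α * β - 1 / 2) = r ∧ r ≤ s))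
    (hcrit_s : ¬ (α = 2 * s / (q * d) ∧ d * (α * β - 1 / 2) = s ∧ s ≤ r)) :
    ∃ A : ℝ, 0 < A ∧ ∀ h : Set.Ioo (0 : ℝ) 1, (h : ℝ) < h₀ → ∀ k : ℝ, 0 < k → k < 1 →
      ∀ (b : ℕ → ℝ) (f : ℕ → H), (∀ j : Fin (Module.finrank ℝ (V h)),
        b j = scalarQuadrature β k (lamh h j) ∧ f j = eh h j) →
      (∀ j, Module.finrank ℝ (V h) ≤ j → b j = 0) →
      (∀ n, ∑ j ∈ Finset.range n, ‖lam j ^ (-β) • e j - b j • f j‖ ^ 2 ≤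
        A * ((h : ℝ) ^ (min (d * (α * β - 1 / 2)) (min r s)) +
          Real.exp (-Real.pi ^ 2 / (2 * k)) * (h : ℝ) ^ (-(d : ℝ) / 2)) ^ 2) ∧
      ∑ j ∈ Finset.range (Module.finrank ℝ (V h)), b j ^ 2 * ‖e j - f j‖ ^ 2 ≤
        A * ((h : ℝ) ^ (min (d * (α * β - 1 / 2)) (min r s)) +
          Real.exp (-Real.pi ^ 2 / (2 * k)) * (h : ℝ) ^ (-(d : ℝ) / 2)) ^ 2 := by
  obtain ⟨hβ0, hβ1⟩ := id hβ
  have hlam := hgrowth.pos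
  have hd : (0 : ℝ) < d := by exact_mod_cast hFE.d_pos
  have hq := hFE.one_lt_q
  have hr := hFE.r_pos
  have hs := hFE.s_pos
  have hC₁ := hFE.C₁_pos
  have hC₂ := hFE.C₂_pos
  have hp : 0 < 2 * α * β - 1 := by
    rw [div_lt_iff₀ (by positivity)] at hα_lower
    linarith
  have hq1d : 0 < (q - 1) * d := mul_pos (by linarith) hd
  have hqd : 0 < q * d := mul_pos (by linarith) hd
  have hαr := (le_div_iff₀ hq1d).1 (hα_upper.trans (min_le_left _ _))
  have hαs := (le_div_iff₀ hqd).1 (hα_upper.trans (min_le_right _ _))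
  set ρ := min ((d : ℝ) * (α * β - 1 / 2)) (min r s) with hρ
  have hρ1 : ρ ≤ d * (α * β - 1 / 2) := min_le_left _ _
  have hρr : ρ ≤ r := (min_le_right _ _).trans (min_le_left _ _)
  have hρs : ρ ≤ s := (min_le_right _ _).trans (min_le_right _ _)
  obtain ⟨c, c', hc, hc', hdim⟩ := hFE.dim
  obtain ⟨M₁, hM₁, hlam₁⟩ := hgrowth.exists_rpow_le (q - 2 * β)
  obtain ⟨M₂, hM₂, hlam₂⟩ := hgrowth.exists_rpow_le (2 * (q - 1 - β))
  obtain ⟨M₃, hM₃, hlam₃⟩ := hgrowth.exists_rpow_le (-(2 * β))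
  obtain ⟨m, hm, hlam₀⟩ : ∃ m : ℝ, 0 < m ∧ ∀ j, m ≤ lam j := by
    obtain ⟨c, C, hc, -, hb⟩ := hgrowth
    refine ⟨c, hc, fun j => le_trans ?_ (hb j).1⟩
    have hα0 : 0 ≤ α := by
      by_contra hα
      nlinarith [mul_neg_of_neg_of_pos (not_le.1 hα) hβ0]
    exact le_mul_of_one_le_right hc.le
      (Real.one_le_rpow (by linarith [(Nat.cast_nonneg j : (0:ℝ) ≤ j)]) hα0)
  -- Adding `αqd ≤ 2s` and `2ρ ≤ 2d(αβ - 1/2)` gives the exponent condition. If `γ = -1` and `ρ =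
  -- s`, both are equalities, which is borderline case (ii); the next sum leads to case (i) in the
  -- same way.
  obtain ⟨K₁, hK₁, hsum₁⟩ := exists_rpow_mul_sum_range_le (γ := α * (q - 2 * β)) (t := s) (ρ := ρ)
    hd hc' hρs (by linarith) (by
      rintro ⟨h1, h2⟩
      have h3 := congrArg ((d : ℝ) * ·) h1
      refine hcrit_s ⟨?_, by linarith, h2 ▸ hρr⟩
      rw [eq_div_iff hqd.ne']
      linarith)
  obtain ⟨K₂, hK₂, hsum₂⟩ := exists_rpow_mul_sum_range_le (γ := α * (2 * (q - 1 - β))) (t := r)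
    (ρ := ρ) hd hc' hρr (by linarith) (by
      rintro ⟨h1, h2⟩
      have h3 := congrArg ((d : ℝ) * ·) h1
      refine hcrit_r ⟨?_, by linarith, h2 ▸ hρs⟩
      rw [eq_div_iff hq1d.ne']
      linarith)
  obtain ⟨CQ, hCQ, hquad⟩ := exists_abs_rpow_sub_scalarQuadrature_le hβ hm
  refine ⟨3 * (C₂ * M₁ * K₁) + 3 * (C₁ ^ 2 * M₂ * K₂) + 8 * CQ ^ 2 * c' +
    M₃ * ((2 * α * β - 1)⁻¹ * c ^ (-(2 * α * β - 1))), by positivity, ?_⟩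
  intro h hh k hk hk1 b f hbf hb0
  obtain ⟨hh0, hh1⟩ := h.2
  obtain ⟨hdim1, hdim2⟩ := hdim h
  set N := Module.finrank ℝ (V h) with hN
  have hN1 : 1 ≤ N := by
    have : (0 : ℝ) < N := lt_of_lt_of_le (by positivity) hdim1
    exact_mod_cast this
  set ε := Real.exp (-Real.pi ^ 2 / (2 * k)) with hε
  have hε0 : 0 < ε := Real.exp_pos _
  set U : ℕ → ℝ := fun j => 3 * (C₂ * M₁ * ((h : ℝ) ^ (2 * s) * ((j : ℝ) + 1) ^ (α * (q - 2 * β)))) +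
    3 * (C₁ ^ 2 * M₂ * ((h : ℝ) ^ (2 * r) * ((j : ℝ) + 1) ^ (α * (2 * (q - 1 - β))))) +
      8 * (CQ * ε) ^ 2 with hU
  have hU0 : ∀ j, 0 ≤ U j := fun j => by simp only [hU]; positivity
  have hterm : ∀ j < N, ‖lam j ^ (-β) • e j - b j • f j‖ ^ 2 ≤ U j ∧
      b j ^ 2 * ‖e j - f j‖ ^ 2 ≤ U j := by
    intro j hj
    obtain ⟨hb, hf⟩ := hbf ⟨j, hj⟩
    obtain ⟨hl1, hl2⟩ := hFE.eigenvalues h hh ⟨j, hj⟩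
    have hv := hFE.eigenvectors h hh ⟨j, hj⟩
    simp only at hb hf hl1 hl2 hv
    have hf1 : ‖f j‖ = 1 := by
      rw [hf]
      exact (eh h).orthonormal.1 _
    rw [← hf] at hv
    have hη : |lamh h ⟨j, hj⟩ ^ (-β) - b j| ≤ CQ * ε := by
      rw [hb]
      exact hquad k hk hk1 _ ((hlam₀ j).trans hl1)
    have hle : lamh h ⟨j, hj⟩ ^ (-β) ≤ lam j ^ (-β) :=
      Real.rpow_le_rpow_of_nonpos (hlam j) hl1 (by linarith)
    have hP : (lam j ^ (-β)) ^ 2 * ‖e j - f j‖ ^ 2 ≤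
        C₂ * M₁ * ((h : ℝ) ^ (2 * s) * ((j : ℝ) + 1) ^ (α * (q - 2 * β))) := by
      calc _ ≤ (lam j ^ (-β)) ^ 2 * (C₂ * (h : ℝ) ^ (2 * s) * lam j ^ q) := by gcongr
        _ = C₂ * (h : ℝ) ^ (2 * s) * lam j ^ (q - 2 * β) := by
            rw [← Real.rpow_natCast, ← Real.rpow_mul (hlam j).le,
              show q - 2 * β = -β * (2 : ℕ) + q by push_cast; ring, Real.rpow_add (hlam j)]
            ring
        _ ≤ C₂ * (h : ℝ) ^ (2 * s) * (M₁ * ((j : ℝ) + 1) ^ (α * (q - 2 * β))) := by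
            gcongr
            exact hlam₁ j
        _ = _ := by ring
    have hR : (lam j ^ (-β) - lamh h ⟨j, hj⟩ ^ (-β)) ^ 2 ≤
        C₁ ^ 2 * M₂ * ((h : ℝ) ^ (2 * r) * ((j : ℝ) + 1) ^ (α * (2 * (q - 1 - β)))) := by
      have h1 : |lam j ^ (-β) - lamh h ⟨j, hj⟩ ^ (-β)| ≤
          C₁ * (h : ℝ) ^ r * lam j ^ (q - 1 - β) := by
        refine (abs_rpow_neg_sub_rpow_neg_le hβ0 hβ1 (hlam j) hl1).trans ?_
        calc _ ≤ lam j ^ (-β - 1) * (C₁ * (h : ℝ) ^ r * lam j ^ q) := by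
              have := hlam j
              gcongr
              linarith
          _ = _ := by
              rw [show q - 1 - β = (-β - 1) + q by ring, Real.rpow_add (hlam j)]
              ring
      calc _ = |lam j ^ (-β) - lamh h ⟨j, hj⟩ ^ (-β)| ^ 2 := (sq_abs _).symm
        _ ≤ (C₁ * (h : ℝ) ^ r * lam j ^ (q - 1 - β)) ^ 2 := by gcongr
        _ = C₁ ^ 2 * (h : ℝ) ^ (2 * r) * lam j ^ (2 * (q - 1 - β)) := by
            rw [mul_pow, mul_pow, ← Real.rpow_natCast ((h : ℝ) ^ r), ← Real.rpow_mul hh0.le,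
              ← Real.rpow_natCast (lam j ^ _), ← Real.rpow_mul (hlam j).le]
            push_cast
            rw [mul_comm r, mul_comm (q - 1 - β)]
        _ ≤ C₁ ^ 2 * (h : ℝ) ^ (2 * r) * (M₂ * ((j : ℝ) + 1) ^ (α * (2 * (q - 1 - β)))) := by
            gcongr
            exact hlam₂ j
        _ = _ := by ring
    have hc0 : 0 ≤ lamh h ⟨j, hj⟩ ^ (-β) := Real.rpow_nonneg ((hlam j).le.trans hl1) _
    constructor
    · refine (norm_smul_sub_smul_sq_le hf1 hη).trans ?_
      simp only [hU]
      gcongr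
    · refine (sq_mul_norm_sub_sq_le (e.orthonormal.1 j) hf1 hη hc0 hle).trans ?_
      simp only [hU]
      gcongr
  set W := ((h : ℝ) ^ ρ + ε * (h : ℝ) ^ (-(d : ℝ) / 2)) ^ 2 with hW
  have hW1 : (h : ℝ) ^ (2 * ρ) ≤ W := by
    rw [mul_comm, Real.rpow_mul hh0.le, Real.rpow_two]
    have : 0 ≤ ε * (h : ℝ) ^ (-(d : ℝ) / 2) := by positivity
    rw [hW]
    gcongr
    linarith
  have hW2 : ε ^ 2 * (h : ℝ) ^ (-(d : ℝ)) ≤ W := by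
    have e1 : (h : ℝ) ^ (-(d : ℝ)) = ((h : ℝ) ^ (-(d : ℝ) / 2)) ^ 2 := by
      rw [← Real.rpow_natCast, ← Real.rpow_mul hh0.le]
      congr 1; push_cast; ring
    have : 0 ≤ (h : ℝ) ^ ρ := by positivity
    rw [e1, ← mul_pow, hW]
    gcongr
    linarith
  have hsumU : ∑ j ∈ Finset.range N, U j ≤
      (3 * (C₂ * M₁ * K₁) + 3 * (C₁ ^ 2 * M₂ * K₂) + 8 * CQ ^ 2 * c') * W := by
    simp only [hU, Finset.sum_add_distrib, ← Finset.mul_sum, Finset.sum_const, Finset.card_range,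
      nsmul_eq_mul]
    rw [add_mul, add_mul]
    refine add_le_add (add_le_add ?_ ?_) ?_
    · have h1 := (hsum₁ h N hh0 hN1 hdim2).trans (mul_le_mul_of_nonneg_left hW1 hK₁.le)
      refine (mul_le_mul_of_nonneg_left (mul_le_mul_of_nonneg_left h1
        (by positivity : 0 ≤ C₂ * M₁)) zero_le_three).trans_eq ?_
      ring
    · have h1 := (hsum₂ h N hh0 hN1 hdim2).trans (mul_le_mul_of_nonneg_left hW1 hK₂.le)
      refine (mul_le_mul_of_nonneg_left (mul_le_mul_of_nonneg_left h1
        (by positivity : 0 ≤ C₁ ^ 2 * M₂)) zero_le_three).trans_eq ?_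
      ring
    · calc _ = N * (8 * (CQ * ε) ^ 2) := by ring
        _ ≤ (c' * (h : ℝ) ^ (-(d : ℝ))) * (8 * (CQ * ε) ^ 2) :=
          mul_le_mul_of_nonneg_right hdim2 (by positivity)
        _ = 8 * CQ ^ 2 * c' * (ε ^ 2 * (h : ℝ) ^ (-(d : ℝ))) := by ring
        _ ≤ _ := mul_le_mul_of_nonneg_left hW2 (by positivity)
  have hW0 : 0 ≤ W := sq_nonneg _
  have htail : ∀ n, N ≤ n → ∑ j ∈ Finset.Ico N n, ‖lam j ^ (-β) • e j - b j • f j‖ ^ 2 ≤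
      M₃ * ((2 * α * β - 1)⁻¹ * c ^ (-(2 * α * β - 1))) * W := by
    intro n hn
    calc _ ≤ ∑ j ∈ Finset.Ico N n, M₃ * ((j : ℝ) + 1) ^ (-(2 * α * β - 1) - 1) := by
          refine Finset.sum_le_sum fun j hj => ?_
          rw [hb0 j (Finset.mem_Ico.1 hj).1, zero_smul, sub_zero, norm_smul, e.orthonormal.1 j,
            mul_one, Real.norm_eq_abs, sq_abs, ← Real.rpow_natCast, ← Real.rpow_mul (hlam j).le,
            show -β * (2 : ℕ) = -(2 * β) by push_cast; ring]
          refine (hlam₃ j).trans_eq ?_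
          congr 2; ring
      _ ≤ M₃ * ((2 * α * β - 1)⁻¹ * (N : ℝ) ^ (-(2 * α * β - 1))) := by
          rw [← Finset.mul_sum]
          gcongr
          exact sum_Ico_rpow_le hp hN1 hn
      _ ≤ M₃ * ((2 * α * β - 1)⁻¹ * (c * (h : ℝ) ^ (-(d : ℝ))) ^ (-(2 * α * β - 1))) := by
          gcongr M₃ * (_ * ?_)
          exact Real.rpow_le_rpow_of_nonpos (by positivity) hdim1 (by linarith)
      _ = M₃ * ((2 * α * β - 1)⁻¹ * c ^ (-(2 * α * β - 1))) *
          (h : ℝ) ^ (d * (2 * α * β - 1)) := by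
          rw [Real.mul_rpow hc.le (by positivity), ← Real.rpow_mul hh0.le, neg_mul_neg]
          ring
      _ ≤ M₃ * ((2 * α * β - 1)⁻¹ * c ^ (-(2 * α * β - 1))) * (h : ℝ) ^ (2 * ρ) := by
          refine mul_le_mul_of_nonneg_left ?_ (by positivity)
          exact Real.rpow_le_rpow_of_exponent_ge hh0 hh1.le (by linarith)
      _ ≤ _ := mul_le_mul_of_nonneg_left hW1 (by positivity)
  have htail0 : 0 ≤ M₃ * ((2 * α * β - 1)⁻¹ * c ^ (-(2 * α * β - 1))) * W := by positivity
  rw [add_mul]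
  refine ⟨fun n => ?_, ?_⟩
  · calc _ ≤ ∑ j ∈ Finset.range (max N n), ‖lam j ^ (-β) • e j - b j • f j‖ ^ 2 :=
          Finset.sum_le_sum_of_subset_of_nonneg (Finset.range_mono (le_max_right _ _))
            fun _ _ _ => sq_nonneg _
      _ = ∑ j ∈ Finset.range N, ‖lam j ^ (-β) • e j - b j • f j‖ ^ 2 +
          ∑ j ∈ Finset.Ico N (max N n), ‖lam j ^ (-β) • e j - b j • f j‖ ^ 2 :=
          (Finset.sum_range_add_sum_Ico _ (le_max_left _ _)).symm
      _ ≤ _ := by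
          refine add_le_add (le_trans ?_ hsumU) (htail _ (le_max_left _ _))
          exact Finset.sum_le_sum fun j hj => (hterm j (Finset.mem_range.1 hj)).1
  · refine le_trans ((Finset.sum_le_sum fun j hj => (hterm j (Finset.mem_range.1 hj)).2).trans
      hsumU) (le_add_of_nonneg_right htail0)

end FracSPDE
end

theorem mainTheorem1
    {H : Type*} [NormedAddCommGroup H] [InnerProductSpace ℝ H] [CompleteSpace H]
    (L : H →ₗ.[ℝ] H) (hL : FracSPDE.IsAdmissibleOperator L)
    (e : HilbertBasis ℕ ℝ H) (lam : ℕ → ℝ) (he : FracSPDE.IsEigenbasis L e lam)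
    {Ω : Type*} [MeasurableSpace Ω] (μ : Measure Ω) [IsProbabilityMeasure μ]
    (ξ : ℕ → Ω → ℝ) (hξ : FracSPDE.IsStdNormalSeq μ ξ)
    (V : Set.Ioo (0 : ℝ) 1 → Submodule ℝ H) [∀ h, FiniteDimensional ℝ (V h)]
    (hV : ∀ h, V h ≤ FracSPDE.fracDomain e lam (1 / 2))
    (eh : ∀ h, OrthonormalBasis (Fin (Module.finrank ℝ (V h))) ℝ (V h))
    (lamh : ∀ h, Fin (Module.finrank ℝ (V h)) → ℝ)
    (heh : ∀ h, FracSPDE.IsGalerkinEigenbasis e lam (V h) (hV h) (eh h) (lamh h))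
    (d : ℕ) (h₀ C₁ C₂ r s q : ℝ)
    (hFE : FracSPDE.FEAssumption e lam V eh lamh d h₀ C₁ C₂ r s q)
    (α β : ℝ) (hβ : β ∈ Set.Ioo (0 : ℝ) 1)
    (hgrowth : FracSPDE.EigenvalueGrowth lam α)
    (hα_lower : 1 / (2 * β) < α)
    (hα_upper : α ≤ min (r / ((q - 1) * d)) (2 * s / (q * d)))
    (hcrit_r : ¬ (α = r / ((q - 1) * d) ∧ d * (α * β - 1 / 2) = r ∧ r ≤ s))
    (hcrit_s : ¬ (α = 2 * s / (q * d) ∧ d * (α * β - 1 / 2) = s ∧ s ≤ r)) :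
    ∃ k₀ C : ℝ, 0 < k₀ ∧ 0 < C ∧ ∀ g : H, ∃ u : Ω → H,
      MemLp u 2 μ ∧ FracSPDE.IsSolution e lam β μ ξ g u ∧
      (∀ v : Ω → H, FracSPDE.IsSolution e lam β μ ξ g v → v =ᵐ[μ] u) ∧
      ∀ h : Set.Ioo (0 : ℝ) 1, (h : ℝ) < h₀ → ∀ k : ℝ, 0 < k → k < k₀ →
        ∀ Φ : Module.Basis (Fin (Module.finrank ℝ (V h))) ℝ (V h),
          MemLp (FracSPDE.approxSolution e lam (V h) (hV h) (eh h) Φ β k ξ g) 2 μ ∧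
          eLpNorm (fun ω => u ω -
              FracSPDE.approxSolution e lam (V h) (hV h) (eh h) Φ β k ξ g ω) 2 μ ≤
            ENNReal.ofReal
              (C * ((h : ℝ) ^ (min (d * (α * β - 1 / 2)) (min r s)) +
                Real.exp (-Real.pi ^ 2 / (2 * k)) * (h : ℝ) ^ (-(d : ℝ) / 2)) * (1 + ‖g‖)) := by
  have hlam := hgrowth.pos
  have ha : Summable fun j => (lam j ^ (-β)) ^ 2 := by
    obtain ⟨M, hM, hle⟩ := hgrowth.exists_rpow_le (-(2 * β))
    have hlt : α * -(2 * β) < -1 := by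
      have hβ0 := hβ.1
      rw [div_lt_iff₀ (by positivity)] at hα_lower
      linarith
    have hs : Summable fun j : ℕ => M * ((j : ℝ) + 1) ^ (α * -(2 * β)) := by
      have := (summable_nat_add_iff 1).2 (Real.summable_nat_rpow.2 hlt)
      exact Summable.mul_left _ (by simpa using this)
    refine hs.of_nonneg_of_le (fun j => sq_nonneg _) fun j => le_of_eq_of_le ?_ (hle j)
    rw [← Real.rpow_natCast, ← Real.rpow_mul (hlam j).le]
    congr 1; push_cast; ring
  obtain ⟨A, hA, herr⟩ := FracSPDE.exists_error_sums_le hFE hβ hgrowth hα_lower hα_upper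
    hcrit_r hcrit_s
  -- The range `k < 1` comes from the Fourier decay estimate. The factor `2` comes from `√S + (√S +
  -- √T)‖g‖` with `√S = √T`.
  refine ⟨1, 2 * √A, one_pos, by positivity, fun g => ⟨_, FracSPDE.memLp_seriesSolution hξ e ha g,
    FracSPDE.isSolution_seriesSolution hξ e hlam ha g, fun v hv =>
      (FracSPDE.isSolution_seriesSolution hξ e hlam ha g).ae_eq hlam hv, ?_⟩⟩
  intro h hh k hk hk1 Φ
  -- Extension by zero to all of `ℕ` lets one series contain both the discrete error and the
  -- truncation tail; `f` past the dimension is irrelevant because `b` vanishes there.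
  set b : ℕ → ℝ := fun j =>
    if hj : j < Module.finrank ℝ (V h) then FracSPDE.scalarQuadrature β k (lamh h ⟨j, hj⟩) else 0 with hb
  set f : ℕ → H := fun j => if hj : j < Module.finrank ℝ (V h) then (eh h ⟨j, hj⟩ : H) else 0 with hf
  have hbf : ∀ j : Fin (Module.finrank ℝ (V h)), b j = FracSPDE.scalarQuadrature β k (lamh h j) ∧ f j = eh h j :=
    fun j => ⟨by simp [hb], by simp [hf]⟩
  have hb0 : ∀ j, Module.finrank ℝ (V h) ≤ j → b j = 0 := fun j hj => dif_neg (not_lt.2 hj)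
  have happrox : FracSPDE.approxSolution e lam (V h) (hV h) (eh h) Φ β k ξ g =
      fun ω => ∑ j ∈ Finset.range (Module.finrank ℝ (V h)), (b j * (⟪f j, g⟫ + ξ j ω)) • f j := by
    ext ω
    rw [FracSPDE.approxSolution_eq_sum (heh h)
      (fun j => (hlam j).trans_le (hFE.eigenvalues h hh j).1), Finset.sum_range]
    refine Finset.sum_congr rfl fun j _ => ?_
    rw [(hbf j).1, (hbf j).2]
  have hforth : Orthonormal ℝ fun j : Fin (Module.finrank ℝ (V h)) => f j := by
    have : (fun j : Fin (Module.finrank ℝ (V h)) => f j) = fun j => (eh h j : H) := funext fun j => (hbf j).2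
    rw [this]
    have h1 := (eh h).orthonormal
    exact ⟨fun j => h1.1 j, fun i j hij => h1.2 hij⟩
  obtain ⟨hS, hT⟩ := herr h hh k hk hk1 b f hbf hb0
  rw [happrox]
  refine ⟨?_, ?_⟩
  · have : (fun ω => ∑ j ∈ Finset.range (Module.finrank ℝ (V h)), (b j * (⟪f j, g⟫ + ξ j ω)) • f j) =
        (fun ω => ∑ j ∈ Finset.range (Module.finrank ℝ (V h)), ξ j ω • (b j • f j)) +
          fun _ => ∑ j ∈ Finset.range (Module.finrank ℝ (V h)), (b j * ⟪f j, g⟫) • f j := by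
      ext ω
      simp only [Pi.add_apply]
      rw [← Finset.sum_add_distrib]
      refine Finset.sum_congr rfl fun j _ => ?_
      rw [smul_smul, ← add_smul]
      congr 1; ring
    rw [this]
    exact (hξ.memLp_sum_smul (fun j => b j • f j) _).add (memLp_const _)
  · have hbound := FracSPDE.eLpNorm_seriesSolution_sub_le hξ e ha g hforth hb0 hS hT
    refine hbound.trans (ENNReal.ofReal_le_ofReal ?_)
    have hh0 := h.2.1
    set W := (h : ℝ) ^ (min (d * (α * β - 1 / 2)) (min r s)) +
      Real.exp (-Real.pi ^ 2 / (2 * k)) * (h : ℝ) ^ (-(d : ℝ) / 2) with hW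
    have hW0 : 0 ≤ W := by positivity
    rw [Real.sqrt_mul hA.le, Real.sqrt_sq hW0]
    have : 0 ≤ √A * W := by positivity
    linarith
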